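/- Notation. For $\beta\in\mathbb R$ let $H^\beta_c=H^\beta(\mathbb T,\mathbb C)$, $\mathbb T=\mathbb R/2\pi\mathbb Z$, with norm $\|u\|_\beta=\big(\sum_{n\in\mathbb Z}\langle n\rangle^{2\beta}|\widehat u(n)|^2\big)^{1/2}$, $\langle n\rangle=\max\{1,|n|\}$; let $H^\beta_{c,0}=\{u\in H^\beta_c : \widehat u(0)=0\}$ and $H^\beta_+=\{f\in H^\beta_c : \widehat f(n)=0\ \ \forall n<0\}$, and let $\mathfrak h^\beta_+$ be the Hilbert space of complex sequences $z=(z_n)_{n\ge1}$ with norm $\big(\sum_{n\ge1}n^{2\beta}|z_n|^2\big)^{1/2}<\infty$. Put $e_n=e^{inx}$, $\langle f,g\rangle=\sum_{n\in\mathbb Z}\widehat f(n)\widehat g(-n)$ and $\langle f|g\rangle=\sum_{n\in\mathbb Z}\widehat f(n)\overline{\widehat g(n)}$. Let $s>-1/2$ and $\sigma=\min(s,0)$. For $u\in H^s_{c,0}$ let $L_u=D-T_u : H^{1+\sigma}_+\to H^{\sigma}_+$ be the Lax operator of the Benjamin--Ono equation, where $D=-i\partial_x$, $T_uf=\Pi(uf)$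 and $\Pi:H^\sigma_c\to H^\sigma_+$ is the Szegő projector, $\widehat{\Pi v}(n)=\widehat v(n)$ for $n\ge0$. For $n\ge 0$ let $$P_n(u)=-\frac1{2\pi i}\oint_{|\lambda-n|=1/3}(L_u-\lambda)^{-1}\,d\lambda\in\mathcal L\big(H^\sigma_+,H^{1+\sigma}_+\big),\qquad h_n(u)=P_n(u)e_n\in H^{1+\sigma}_+ ,$$ whenever the (counterclockwise oriented) circle $|\lambda-n|=1/3$ lies in the resolvent set of $L_u$. Proposition. For any $s>-1/2$ there exists an open neighborhood $U^s$ of zero in $H^s_{c,0}$ such that for all $u\in U^s$ and $n\ge0$ the projector $P_n(u)$ is well defined, and the following holds: (i) for $u\in U^s$ the sequence $\big(\langle 1,h_n(u)\rangle\big)_{n\ge1}$ belongs to $\mathfrak h^{1+s}_+$, and the pre-Birkhoff map $$\Psi:U^s\to\mathfrak h^{1+s}_+,\qquad u\mapsto\big(\langle 1,h_n(u)\rangle\big)_{n\ge1},$$ is analytic; (ii) for any $n\ge0$, the map $U^s\to\mathbb C$, $u\mapsto\langle h_n(u)|e_n\rangle$, is analytic and $$\big|\langle h_n(u)|e_n\rangle\big|\ge\tfrac12\qquad\forall\,u\in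 U^s .$$ -/

import Mathlib

namespace BenjaminOno

noncomputable section

/-! ### Weighted `ℓ²` spaces -/

/-- `⟨n⟩ = max {1, |n|}`. -/
def bracket (n : ℤ) : ℝ := max 1 |(n : ℝ)|

lemma one_le_bracket (n : ℤ) : 1 ≤ bracket n := le_max_left _ _

lemma bracket_pos (n : ℤ) : 0 < bracket n := lt_of_lt_of_le one_pos (one_le_bracket n)

lemma weight_sq (n : ℤ) (β : ℝ) (z : ℂ) :
    ‖((bracket n ^ β : ℝ) : ℂ) * z‖ ^ 2 = bracket n ^ (2 * β) * ‖z‖ ^ 2 := by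
  have h := (Real.rpow_pos_of_pos (bracket_pos n) β).le
  rw [norm_mul, Complex.norm_real, Real.norm_of_nonneg h, mul_pow, mul_comm 2 β,
    Real.rpow_mul (bracket_pos n).le]
  norm_num

lemma memℓp_weight_iff {ι : Type} (k : ι → ℤ) (β : ℝ) (u : ι → ℂ) :
    Memℓp (fun i => ((bracket (k i) ^ β : ℝ) : ℂ) * u i) 2 ↔
      Summable fun i => bracket (k i) ^ (2 * β) * ‖u i‖ ^ 2 := by
  rw [memℓp_gen_iff (by norm_num)]
  refine summable_congr fun i => ?_
  rw [← weight_sq]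
  norm_num

/-- The sequences `(u i)` with `∑ ⟨k i⟩^{2β} |u i|² < ∞`, as a subspace of all sequences. -/
def seqSubmodule {ι : Type} (k : ι → ℤ) (β : ℝ) : Submodule ℂ (ι → ℂ) where
  carrier := {u | Summable fun i => bracket (k i) ^ (2 * β) * ‖u i‖ ^ 2}
  zero_mem' := by simp [summable_zero]
  add_mem' := by
    intro u v hu hv
    have hu' := (memℓp_weight_iff k β u).2 hu
    have hv' := (memℓp_weight_iff k β v).2 hv
    refine (memℓp_weight_iff k β (u + v)).1 ?_
    convert hu'.add hv' using 1
    funext i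
    simp [mul_add]
  smul_mem' := by
    intro c u hu
    have hu' := (memℓp_weight_iff k β u).2 hu
    refine (memℓp_weight_iff k β (c • u)).1 ?_
    convert hu'.const_smul c using 1
    funext i
    simp [mul_left_comm]

/-- The Hilbert space of sequences `(u i)` with norm `(∑ ⟨k i⟩^{2β} |u i|²)^{1/2}`
(see `SeqSpace.norm_eq`). -/
def SeqSpace {ι : Type} (k : ι → ℤ) (β : ℝ) : Type := ↥(seqSubmodule k β)

namespace SeqSpace

variable {ι : Type} {k : ι → ℤ} {β : ℝ}

instance : AddCommGroup (SeqSpace k β) := inferInstanceAs (AddCommGroup ↥(seqSubmodule k β))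

instance : Module ℂ (SeqSpace k β) := inferInstanceAs (Module ℂ ↥(seqSubmodule k β))

/-- The underlying sequence. -/
def coeff : SeqSpace k β →ₗ[ℂ] (ι → ℂ) := (seqSubmodule k β).subtype

/-- A sequence of finite norm, as an element of the space. -/
def mk (u : ι → ℂ) (hu : Summable fun i => bracket (k i) ^ (2 * β) * ‖u i‖ ^ 2) :
    SeqSpace k β := ⟨u, hu⟩

@[simp] lemma coeff_mk (u : ι → ℂ)
    (hu : Summable fun i => bracket (k i) ^ (2 * β) * ‖u i‖ ^ 2) :
    coeff (mk u hu : SeqSpace k β) = u := rfl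

lemma summable_coeff (u : SeqSpace k β) :
    Summable fun i => bracket (k i) ^ (2 * β) * ‖coeff u i‖ ^ 2 := u.2

lemma coeff_injective : Function.Injective (coeff : SeqSpace k β → (ι → ℂ)) :=
  Subtype.coe_injective

@[ext] lemma ext {u v : SeqSpace k β} (h : ∀ i, coeff u i = coeff v i) : u = v :=
  coeff_injective (funext h)

/-- `u ↦ (⟨k i⟩^β u i)`, which defines the norm. -/
def toLp : SeqSpace k β →ₗ[ℂ] lp (fun _ : ι => ℂ) 2 where
  toFun u := ⟨fun i => ((bracket (k i) ^ β : ℝ) : ℂ) * coeff u i,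
    (memℓp_weight_iff k β _).2 (summable_coeff u)⟩
  map_add' u v := by
    ext i
    change _ * coeff (u + v) i = _ * coeff u i + _ * coeff v i
    simp [mul_add]
  map_smul' c u := by ext i; simp [mul_left_comm]

lemma toLp_apply (u : SeqSpace k β) (i : ι) :
    (toLp u : ι → ℂ) i = ((bracket (k i) ^ β : ℝ) : ℂ) * coeff u i := rfl

lemma weight_ne (n : ℤ) (β : ℝ) : ((bracket n ^ β : ℝ) : ℂ) ≠ 0 :=
  Complex.ofReal_ne_zero.2 (Real.rpow_pos_of_pos (bracket_pos n) β).ne'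

lemma toLp_bijective : Function.Bijective (toLp : SeqSpace k β → lp (fun _ : ι => ℂ) 2) := by
  constructor
  · intro u v h
    ext i
    have := congrArg (fun w : lp (fun _ : ι => ℂ) 2 => (w : ι → ℂ) i) h
    simp only [toLp_apply] at this
    exact mul_left_cancel₀ (weight_ne _ _) this
  · intro w
    have key : (fun i => ((bracket (k i) ^ β : ℝ) : ℂ) *
        ((((bracket (k i) ^ β : ℝ) : ℂ))⁻¹ * (w : ι → ℂ) i)) = (w : ι → ℂ) := by
      funext i
      rw [mul_inv_cancel_left₀ (weight_ne _ _)]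
    refine ⟨mk (fun i => (((bracket (k i) ^ β : ℝ) : ℂ))⁻¹ * (w : ι → ℂ) i) ?_, ?_⟩
    · rw [← memℓp_weight_iff, key]
      exact lp.memℓp w
    · ext i
      exact congrFun key i

instance : NormedAddCommGroup (SeqSpace k β) :=
  NormedAddCommGroup.induced _ _ (toLp (k := k) (β := β)) toLp_bijective.1

instance : NormedSpace ℂ (SeqSpace k β) :=
  NormedSpace.induced ℂ _ _ (toLp (k := k) (β := β))

lemma norm_toLp (u : SeqSpace k β) : ‖toLp u‖ = ‖u‖ := rfl

lemma norm_sq (u : SeqSpace k β) :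
    ‖u‖ ^ 2 = ∑' i, bracket (k i) ^ (2 * β) * ‖coeff u i‖ ^ 2 := by
  have h := lp.norm_rpow_eq_tsum (p := 2) (by norm_num) (toLp u)
  rw [norm_toLp] at h
  norm_num at h
  rw [h]
  refine tsum_congr fun i => ?_
  rw [← weight_sq, ← toLp_apply]

lemma norm_eq (u : SeqSpace k β) :
    ‖u‖ = √(∑' i, bracket (k i) ^ (2 * β) * ‖coeff u i‖ ^ 2) := by
  rw [← norm_sq, Real.sqrt_sq (norm_nonneg u)]

instance : CompleteSpace (SeqSpace k β) := by
  let e : SeqSpace k β ≃ₗᵢ[ℂ] lp (fun _ : ι => ℂ) 2 :=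
    { LinearEquiv.ofBijective toLp toLp_bijective with norm_map' := norm_toLp }
  exact (completeSpace_congr (e := e.toEquiv) e.isometry.isUniformEmbedding).2 inferInstance

lemma norm_coeff_le (u : SeqSpace k β) (i : ι) : bracket (k i) ^ β * ‖coeff u i‖ ≤ ‖u‖ := by
  have h := lp.norm_apply_le_norm (p := 2) (by norm_num) (toLp u) i
  rw [norm_toLp, toLp_apply, norm_mul, Complex.norm_real,
    Real.norm_of_nonneg (Real.rpow_pos_of_pos (bracket_pos _) _).le] at h
  exact h

lemma continuous_coeff (i : ι) : Continuous fun u : SeqSpace k β => coeff u i := by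
  let f : SeqSpace k β →ₗ[ℂ] ℂ := (LinearMap.proj i).comp coeff
  refine (f.mkContinuous (bracket (k i) ^ β)⁻¹ fun u => ?_).continuous
  rw [inv_mul_eq_div, le_div_iff₀ (Real.rpow_pos_of_pos (bracket_pos _) _), mul_comm]
  exact norm_coeff_le u i

end SeqSpace

open SeqSpace

/-! ### The function spaces -/

/-- The Sobolev space `H^β_c = H^β(𝕋, ℂ)`; `coeff u n` is the Fourier coefficient `û(n)`. -/
abbrev Sobolev (β : ℝ) : Type := SeqSpace (fun n : ℤ => n) β

/-- `H^β_{c,0}`: the elements of mean value zero. -/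
def Sobolev₀ (β : ℝ) : Submodule ℂ (Sobolev β) where
  carrier := {u | coeff u 0 = 0}
  zero_mem' := by simp
  add_mem' := by intro u v hu hv; simp_all
  smul_mem' := by intro c u hu; simp_all

/-- The Hardy space `H^β_+`: the elements with `û(n) = 0` for `n < 0`. -/
def Hardy (β : ℝ) : Submodule ℂ (Sobolev β) where
  carrier := {u | ∀ n < 0, coeff u n = 0}
  zero_mem' := by simp
  add_mem' := by intro u v hu hv n hn; simp [hu n hn, hv n hn]
  smul_mem' := by intro c u hu n hn; simp [hu n hn]

instance (β : ℝ) : CompleteSpace (Hardy β) := by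
  have h : IsClosed (Hardy β : Set (Sobolev β)) := by
    have : (Hardy β : Set (Sobolev β)) = ⋂ n : ℤ, ⋂ _ : n < 0, {u | coeff u n = 0} := by
      ext u
      simp [Hardy]
    rw [this]
    exact isClosed_iInter fun n => isClosed_iInter fun _ =>
      isClosed_eq (continuous_coeff n) continuous_const
  exact h.completeSpace_coe

/-- `𝔥^β_+`: the sequences `(z_n)_{n ≥ 1}` with `∑ |n|^{2β} |z_n|² < ∞`; note `⟨n⟩ = n` here. -/
abbrev SeqPlus (β : ℝ) : Type := SeqSpace (fun n : ℕ+ => ((n : ℕ) : ℤ)) β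

/-- The exponential `e_n = e^{inx}`, in any `H^β_c`. -/
def expFun (β : ℝ) (n : ℤ) : Sobolev β :=
  SeqSpace.mk (Pi.single n 1) (summable_of_ne_finset_zero (s := {n}) (by
    intro m hm
    have : m ≠ n := by simpa using hm
    simp [Pi.single_eq_of_ne this]))

/-- `e_n`, `n ≥ 0`, as an element of the Hardy space `H^β_+`. -/
def hardyExp (β : ℝ) (n : ℕ) : Hardy β :=
  ⟨expFun β n, by
    intro m hm
    have : m ≠ (n : ℤ) := by omega
    simp [expFun, Pi.single_eq_of_ne this]⟩

/-- The sesquilinear pairing `⟨f | g⟩ = ∑ f̂(n) conj(ĝ(n))`. -/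
def sesqPair {β γ : ℝ} (f : Sobolev β) (g : Sobolev γ) : ℂ :=
  ∑' n : ℤ, coeff f n * starRingEnd ℂ (coeff g n)

/-- The bilinear pairing `⟨f, g⟩ = ∑ f̂(n) ĝ(-n)`. -/
def bilinPair {β γ : ℝ} (f : Sobolev β) (g : Sobolev γ) : ℂ :=
  ∑' n : ℤ, coeff f n * coeff g (-n)

/-! ### Fourier multipliers: the inclusions and `D = -i∂ₓ` -/

lemma multiplier_summable_norm {β γ C : ℝ} (m : ℤ → ℂ)
    (hm : ∀ n, bracket n ^ γ * ‖m n‖ ≤ C * bracket n ^ β) (u : Sobolev β) :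
    (Summable fun n : ℤ => bracket n ^ (2 * γ) * ‖m n * coeff u n‖ ^ 2) ∧
      ∑' n : ℤ, bracket n ^ (2 * γ) * ‖m n * coeff u n‖ ^ 2 ≤ C ^ 2 * ‖u‖ ^ 2 := by
  have hle : ∀ n : ℤ, bracket n ^ (2 * γ) * ‖m n * coeff u n‖ ^ 2 ≤
      C ^ 2 * (bracket n ^ (2 * β) * ‖coeff u n‖ ^ 2) := by
    intro n
    have e : ∀ δ : ℝ, bracket n ^ (2 * δ) = (bracket n ^ δ) ^ 2 := by
      intro δ
      rw [mul_comm 2 δ, Real.rpow_mul (bracket_pos n).le]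
      norm_num
    have h0 : 0 ≤ bracket n ^ γ * ‖m n‖ :=
      mul_nonneg (Real.rpow_pos_of_pos (bracket_pos n) γ).le (norm_nonneg _)
    have := pow_le_pow_left₀ h0 (hm n) 2
    rw [e, e, norm_mul]
    calc (bracket n ^ γ) ^ 2 * (‖m n‖ * ‖coeff u n‖) ^ 2
        = (bracket n ^ γ * ‖m n‖) ^ 2 * ‖coeff u n‖ ^ 2 := by ring
      _ ≤ (C * bracket n ^ β) ^ 2 * ‖coeff u n‖ ^ 2 := by gcongr
      _ = _ := by ring
  have hs : Summable fun n : ℤ => C ^ 2 * (bracket n ^ (2 * β) * ‖coeff u n‖ ^ 2) :=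
    (summable_coeff u).mul_left _
  have hs' : Summable fun n : ℤ => bracket n ^ (2 * γ) * ‖m n * coeff u n‖ ^ 2 :=
    Summable.of_nonneg_of_le (fun n => by
      have := (Real.rpow_pos_of_pos (bracket_pos n) (2 * γ)).le
      positivity) hle hs
  refine ⟨hs', (hs'.tsum_le_tsum hle hs).trans_eq ?_⟩
  rw [tsum_mul_left, norm_sq]

/-- The Fourier multiplier `û(n) ↦ m(n) û(n)` from `H^β_c` to `H^γ_c`. -/
def multiplier {β γ : ℝ} (m : ℤ → ℂ) (C : ℝ) (hC : 0 ≤ C)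
    (hm : ∀ n, bracket n ^ γ * ‖m n‖ ≤ C * bracket n ^ β) : Sobolev β →L[ℂ] Sobolev γ :=
  LinearMap.mkContinuous
    { toFun := fun u =>
        SeqSpace.mk (fun n => m n * coeff u n) (multiplier_summable_norm m hm u).1
      map_add' := by intro u v; ext n; simp [mul_add]
      map_smul' := by intro c u; ext n; simp [mul_left_comm] }
    C (by
      intro u
      refine abs_le_of_sq_le_sq' ?_ (by positivity) |>.2
      rw [norm_sq, mul_pow]
      exact (multiplier_summable_norm m hm u).2)

/-- The inclusion `H^β_c ⊆ H^γ_c` for `γ ≤ β`. -/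
def incl {β γ : ℝ} (h : γ ≤ β) : Sobolev β →L[ℂ] Sobolev γ :=
  multiplier (fun _ => 1) 1 zero_le_one (by
    intro n
    simpa using Real.rpow_le_rpow_of_exponent_le (one_le_bracket n) h)

@[simp] lemma coeff_incl {β γ : ℝ} (h : γ ≤ β) (u : Sobolev β) (n : ℤ) :
    coeff (incl h u) n = coeff u n := one_mul _

/-- `D = -i∂ₓ : H^{1+σ}_c → H^σ_c`. -/
def diffOp (σ : ℝ) : Sobolev (1 + σ) →L[ℂ] Sobolev σ :=
  multiplier (fun n => (n : ℂ)) 1 zero_le_one (by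
    intro n
    have h1 : ‖(n : ℂ)‖ ≤ bracket n := by
      rw [Complex.norm_intCast]
      exact le_max_right _ _
    have h2 := (Real.rpow_pos_of_pos (bracket_pos n) σ).le
    rw [Real.rpow_add (bracket_pos n), Real.rpow_one, one_mul, mul_comm]
    exact mul_le_mul_of_nonneg_right h1 h2)

@[simp] lemma coeff_diffOp (σ : ℝ) (u : Sobolev (1 + σ)) (n : ℤ) :
    coeff (diffOp σ u) n = n * coeff u n := rfl

/-! ### Toeplitz operators -/

lemma bracket_sub_le (l k : ℤ) : bracket (l - k) ≤ bracket l + bracket k := by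
  have h1 : |(l : ℝ)| ≤ bracket l := le_max_right _ _
  have h2 : |(k : ℝ)| ≤ bracket k := le_max_right _ _
  have := one_le_bracket l
  have := one_le_bracket k
  refine max_le (by linarith) ?_
  push_cast
  exact (abs_sub _ _).trans (by linarith)

lemma bracket_neg (n : ℤ) : bracket (-n) = bracket n := by simp [bracket]

lemma summable_bracket {r : ℝ} (hr : 1 < r) : Summable fun n : ℤ => bracket n ^ (-r) := by
  refine (Real.summable_abs_int_rpow hr).of_norm_bounded_eventually ?_
  have : ∀ᶠ n : ℤ in Filter.cofinite, n ≠ 0 :=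
    (Set.finite_singleton (0 : ℤ)).subset (by intro n hn; simpa using hn)
  filter_upwards [this] with n hn
  have h1 : (1 : ℝ) ≤ |(n : ℝ)| := by
    have := Int.one_le_abs hn
    exact_mod_cast this
  rw [bracket, max_eq_right h1, Real.norm_of_nonneg (by positivity)]

lemma kernel_le {σ : ℝ} (h1 : -1 / 2 < σ) (h0 : σ ≤ 0) (l k : ℤ) :
    bracket l ^ σ ≤ 2 * (bracket k ^ (-1 - σ) + bracket l ^ (-1 - σ)) *
      (bracket (l - k) ^ σ * bracket k ^ (1 + σ)) := by
  set x := bracket l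
  set y := bracket k
  set z := bracket (l - k)
  have hx1 : 1 ≤ x := one_le_bracket l
  have hy1 : 1 ≤ y := one_le_bracket k
  have hx : 0 < x := bracket_pos l
  have hy : 0 < y := bracket_pos k
  have hz : 0 < z := bracket_pos _
  have hxyz : z ≤ x + y := bracket_sub_le l k
  have hzσ : 0 < z ^ σ := Real.rpow_pos_of_pos hz σ
  have hy' : 0 < y ^ (1 + σ) := Real.rpow_pos_of_pos hy _
  have hsub : z ^ (-σ) ≤ x ^ (-σ) + y ^ (-σ) :=
    (Real.rpow_le_rpow hz.le hxyz (by linarith)).trans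
      (Real.rpow_add_le_add_rpow hx.le hy.le (by linarith) (by linarith))
  have hz1 : z ^ (-σ) * z ^ σ = 1 := by
    rw [← Real.rpow_add hz]; simp
  have hy2 : y ^ (-1 - σ) * y ^ (1 + σ) = 1 := by
    rw [← Real.rpow_add hy]; simp
  have main : x ^ σ * (x ^ (-σ) + y ^ (-σ)) ≤
      2 * (y ^ (-1 - σ) + x ^ (-1 - σ)) * y ^ (1 + σ) := by
    have e1 : x ^ σ * x ^ (-σ) = 1 := by rw [← Real.rpow_add hx]; simp
    have p1 : 0 < x ^ (-1 - σ) := Real.rpow_pos_of_pos hx _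
    have e2 : x ^ σ * y ^ (-σ) ≤ 1 + x ^ (-1 - σ) * y ^ (1 + σ) := by
      rcases le_total y x with hyx | hxy
      · have a1 : x ^ σ ≤ y ^ σ := Real.rpow_le_rpow_of_nonpos hy hyx h0
        have a2 : y ^ σ * y ^ (-σ) = 1 := by rw [← Real.rpow_add hy]; simp
        have a3 := mul_le_mul_of_nonneg_right a1 (Real.rpow_pos_of_pos hy (-σ)).le
        have : 0 < x ^ (-1 - σ) * y ^ (1 + σ) := by positivity
        linarith
      · have a1 : x ^ (1 + 2 * σ) ≤ y ^ (1 + 2 * σ) :=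
          Real.rpow_le_rpow hx.le hxy (by linarith)
        have a2 : x ^ σ = x ^ (-1 - σ) * x ^ (1 + 2 * σ) := by
          rw [← Real.rpow_add hx]; ring_nf
        have a3 : y ^ (1 + σ) = y ^ (1 + 2 * σ) * y ^ (-σ) := by
          rw [← Real.rpow_add hy]; ring_nf
        have a4 : x ^ σ * y ^ (-σ) ≤ x ^ (-1 - σ) * y ^ (1 + σ) := by
          rw [a2, a3, mul_assoc]
          have := (Real.rpow_pos_of_pos hy (-σ)).le
          gcongr
        linarith
    have p2 : 0 < x ^ (-1 - σ) * y ^ (1 + σ) := by positivity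
    calc x ^ σ * (x ^ (-σ) + y ^ (-σ)) = x ^ σ * x ^ (-σ) + x ^ σ * y ^ (-σ) := by ring
      _ ≤ 2 * (y ^ (-1 - σ) * y ^ (1 + σ)) + 2 * (x ^ (-1 - σ) * y ^ (1 + σ)) := by
        rw [e1, hy2]; linarith
      _ = _ := by ring
  have hxσ : 0 < x ^ σ := Real.rpow_pos_of_pos hx σ
  calc x ^ σ = x ^ σ * (z ^ (-σ) * z ^ σ) := by rw [hz1, mul_one]
    _ ≤ x ^ σ * ((x ^ (-σ) + y ^ (-σ)) * z ^ σ) := by gcongr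
    _ = x ^ σ * (x ^ (-σ) + y ^ (-σ)) * z ^ σ := by ring
    _ ≤ 2 * (y ^ (-1 - σ) + x ^ (-1 - σ)) * y ^ (1 + σ) * z ^ σ := by gcongr
    _ = _ := by ring

lemma cauchy_schwarz {f g : ℤ → ℝ} (hf : ∀ i, 0 ≤ f i) (hg : ∀ i, 0 ≤ g i)
    (sf : Summable fun i => f i ^ 2) (sg : Summable fun i => g i ^ 2) :
    (Summable fun i => f i * g i) ∧
      (∑' i, f i * g i) ^ 2 ≤ (∑' i, f i ^ 2) * ∑' i, g i ^ 2 := by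
  have hpq : (2 : ℝ).HolderConjugate 2 := Real.HolderConjugate.two_two
  obtain ⟨h1, h2⟩ := Real.summable_and_inner_le_Lp_mul_Lq_tsum_of_nonneg hpq hf hg
    (by simpa using sf) (by simpa using sg)
  refine ⟨h1, ?_⟩
  have n0 : 0 ≤ ∑' i, f i * g i := tsum_nonneg fun i => mul_nonneg (hf i) (hg i)
  have a0 : 0 ≤ ∑' i, f i ^ 2 := tsum_nonneg fun i => sq_nonneg _
  have b0 : 0 ≤ ∑' i, g i ^ 2 := tsum_nonneg fun i => sq_nonneg _
  have h3 : ∑' i, f i * g i ≤ √(∑' i, f i ^ 2) * √(∑' i, g i ^ 2) := by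
    simpa [Real.sqrt_eq_rpow] using h2
  calc (∑' i, f i * g i) ^ 2 ≤ (√(∑' i, f i ^ 2) * √(∑' i, g i ^ 2)) ^ 2 :=
        pow_le_pow_left₀ n0 h3 2
    _ = _ := by rw [mul_pow, Real.sq_sqrt a0, Real.sq_sqrt b0]

lemma conv_bound {a b p : ℤ → ℝ} (ha : ∀ i, 0 ≤ a i) (hb : ∀ i, 0 ≤ b i) (hp : ∀ i, 0 ≤ p i)
    (sa : Summable fun i => a i ^ 2) (sb : Summable fun i => b i ^ 2)
    (sp : Summable fun i => p i ^ 2) :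
    (∀ l, Summable fun k => (p k + p l) * (a (l - k) * b k)) ∧
    (Summable fun l => (∑' k, (p k + p l) * (a (l - k) * b k)) ^ 2) ∧
    ∑' l, (∑' k, (p k + p l) * (a (l - k) * b k)) ^ 2 ≤
      4 * (∑' i, p i ^ 2) * ((∑' i, a i ^ 2) * ∑' i, b i ^ 2) := by
  set A := ∑' i, a i ^ 2
  set B := ∑' i, b i ^ 2
  set P := ∑' i, p i ^ 2
  let e : ℤ × ℤ ≃ ℤ × ℤ :=
    { toFun := fun x => (x.1 - x.2, x.2)
      invFun := fun x => (x.1 + x.2, x.2)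
      left_inv := fun x => by simp
      right_inv := fun x => by simp }
  have s0 : Summable fun x : ℤ × ℤ => a x.1 ^ 2 * b x.2 ^ 2 :=
    sa.mul_of_nonneg sb (fun i => sq_nonneg _) (fun i => sq_nonneg _)
  have s1 : Summable fun x : ℤ × ℤ => (a (x.1 - x.2) * b x.2) ^ 2 := by
    refine ((e.summable_iff).2 s0).congr fun x => ?_
    simp [e, mul_pow]
  have t1 : ∑' l, ∑' k, (a (l - k) * b k) ^ 2 = A * B := by
    rw [sa.tsum_mul_tsum sb s0, ← e.tsum_eq, ← s1.tsum_prod]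
    refine tsum_congr fun x => ?_
    simp [e, mul_pow]
  have sT : Summable fun l => ∑' k, (a (l - k) * b k) ^ 2 := s1.prod
  have sk : ∀ l, Summable fun k => (a (l - k) * b k) ^ 2 := fun l => s1.prod_factor l
  have nab : ∀ l k, 0 ≤ a (l - k) * b k := fun l k => mul_nonneg (ha _) (hb _)
  have c1 := fun l => cauchy_schwarz hp (nab l) sp (sk l)
  have shift : ∀ l, (Summable fun k => a (l - k) ^ 2) ∧ ∑' k, a (l - k) ^ 2 = A := fun l =>
    ⟨((Equiv.subLeft l).summable_iff (f := fun i => a i ^ 2)).2 sa,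
      (Equiv.subLeft l).tsum_eq (fun i => a i ^ 2)⟩
  have c2 := fun l => cauchy_schwarz (fun k => ha (l - k)) hb (shift l).1 sb
  have sum1 : ∀ l, Summable fun k => (p k + p l) * (a (l - k) * b k) := by
    intro l
    refine ((c1 l).1.add ((c2 l).1.mul_left (p l))).congr fun k => ?_
    ring
  have hle : ∀ l, (∑' k, (p k + p l) * (a (l - k) * b k)) ^ 2 ≤
      2 * (P * ∑' k, (a (l - k) * b k) ^ 2) + 2 * (p l ^ 2 * (A * B)) := by
    intro l
    have : ∑' k, (p k + p l) * (a (l - k) * b k) =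
        ∑' k, p k * (a (l - k) * b k) + p l * ∑' k, a (l - k) * b k := by
      rw [← tsum_mul_left, ← (c1 l).1.tsum_add ((c2 l).1.mul_left (p l))]
      refine tsum_congr fun k => ?_
      ring
    rw [this]
    have h1 := (c1 l).2
    have h2 := (c2 l).2
    rw [(shift l).2] at h2
    have h3 := mul_le_mul_of_nonneg_left h2 (sq_nonneg (p l))
    nlinarith [sq_nonneg (∑' k, p k * (a (l - k) * b k) - p l * ∑' k, a (l - k) * b k)]
  have sR : Summable fun l => 2 * (P * ∑' k, (a (l - k) * b k) ^ 2) + 2 * (p l ^ 2 * (A * B)) :=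
    ((sT.mul_left P).mul_left 2).add ((sp.mul_right (A * B)).mul_left 2)
  have sL := Summable.of_nonneg_of_le (fun l => sq_nonneg _) hle sR
  refine ⟨sum1, sL, (sL.tsum_le_tsum hle sR).trans_eq ?_⟩
  rw [((sT.mul_left P).mul_left 2).tsum_add ((sp.mul_right (A * B)).mul_left 2),
    tsum_mul_left, tsum_mul_left, tsum_mul_left, tsum_mul_right, t1]
  ring

/-- A constant in the estimate `‖u f‖_σ ≤ C ‖u‖_σ ‖f‖_{1+σ}`. -/
def convConst (σ : ℝ) : ℝ := 4 * √(∑' n : ℤ, (bracket n ^ (-1 - σ)) ^ 2)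

lemma conv_estimate {σ : ℝ} (h1 : -1 / 2 < σ) (h0 : σ ≤ 0) (u : Sobolev σ)
    (f : Sobolev (1 + σ)) :
    (∀ l : ℤ, Summable fun k : ℤ => coeff u (l - k) * coeff f k) ∧
    (Summable fun l : ℤ =>
      bracket l ^ (2 * σ) * ‖∑' k : ℤ, coeff u (l - k) * coeff f k‖ ^ 2) ∧
    ∑' l : ℤ, bracket l ^ (2 * σ) * ‖∑' k : ℤ, coeff u (l - k) * coeff f k‖ ^ 2 ≤
      (convConst σ * ‖u‖ * ‖f‖) ^ 2 := by
  have e : ∀ (n : ℤ) (δ : ℝ), bracket n ^ (2 * δ) = (bracket n ^ δ) ^ 2 := by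
    intro n δ
    rw [mul_comm 2 δ, Real.rpow_mul (bracket_pos n).le]
    norm_num
  have wp : ∀ (n : ℤ) (δ : ℝ), 0 < bracket n ^ δ := fun n δ =>
    Real.rpow_pos_of_pos (bracket_pos n) δ
  let a : ℤ → ℝ := fun n => bracket n ^ σ * ‖coeff u n‖
  let b : ℤ → ℝ := fun n => bracket n ^ (1 + σ) * ‖coeff f n‖
  let p : ℤ → ℝ := fun n => bracket n ^ (-1 - σ)
  have ha : ∀ i, 0 ≤ a i := fun i => mul_nonneg (wp _ _).le (norm_nonneg _)
  have hb : ∀ i, 0 ≤ b i := fun i => mul_nonneg (wp _ _).le (norm_nonneg _)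
  have hp : ∀ i, 0 ≤ p i := fun i => (wp _ _).le
  have ea : ∀ i, a i ^ 2 = bracket i ^ (2 * σ) * ‖coeff u i‖ ^ 2 := fun i => by
    simp only [a]; rw [e, mul_pow]
  have eb : ∀ i, b i ^ 2 = bracket i ^ (2 * (1 + σ)) * ‖coeff f i‖ ^ 2 := fun i => by
    simp only [b]; rw [e, mul_pow]
  have sa : Summable fun i => a i ^ 2 := by simpa only [ea] using summable_coeff u
  have sb : Summable fun i => b i ^ 2 := by simpa only [eb] using summable_coeff f
  have tA : ∑' i, a i ^ 2 = ‖u‖ ^ 2 := by simp only [ea]; rw [norm_sq]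
  have tB : ∑' i, b i ^ 2 = ‖f‖ ^ 2 := by simp only [eb]; rw [norm_sq]
  have sp : Summable fun i => p i ^ 2 := by
    refine (summable_bracket (r := 2 * (1 + σ)) (by linarith)).congr fun n => ?_
    simp only [p]
    rw [← e]
    ring_nf
  obtain ⟨c1, c2, c3⟩ := conv_bound ha hb hp sa sb sp
  have key : ∀ l k : ℤ, bracket l ^ σ * ‖coeff u (l - k) * coeff f k‖ ≤
      2 * ((p k + p l) * (a (l - k) * b k)) := by
    intro l k
    have hk := mul_le_mul_of_nonneg_right (kernel_le h1 h0 l k)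
      (norm_nonneg (coeff u (l - k) * coeff f k))
    refine hk.trans_eq ?_
    simp only [a, b, p, norm_mul]
    ring
  have sN : ∀ l : ℤ, Summable fun k : ℤ => ‖coeff u (l - k) * coeff f k‖ := by
    intro l
    refine Summable.of_nonneg_of_le (fun k => norm_nonneg _) (fun k => ?_)
      ((c1 l).mul_left ((bracket l ^ σ)⁻¹ * 2))
    rw [mul_assoc, inv_mul_eq_div, le_div_iff₀ (wp l σ), mul_comm]
    exact key l k
  have hle : ∀ l : ℤ, bracket l ^ (2 * σ) * ‖∑' k : ℤ, coeff u (l - k) * coeff f k‖ ^ 2 ≤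
      4 * (∑' k, (p k + p l) * (a (l - k) * b k)) ^ 2 := by
    intro l
    have h : bracket l ^ σ * ‖∑' k : ℤ, coeff u (l - k) * coeff f k‖ ≤
        2 * ∑' k, (p k + p l) * (a (l - k) * b k) := by
      refine (mul_le_mul_of_nonneg_left (norm_tsum_le_tsum_norm (sN l)) (wp l σ).le).trans ?_
      rw [← tsum_mul_left, ← tsum_mul_left]
      exact ((sN l).mul_left _).tsum_le_tsum (key l) ((c1 l).mul_left 2)
    have := pow_le_pow_left₀ (mul_nonneg (wp l σ).le (norm_nonneg _)) h 2
    rw [e, ← mul_pow]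
    refine this.trans_eq ?_
    ring
  have sL := Summable.of_nonneg_of_le
    (fun l => mul_nonneg (wp l (2 * σ)).le (sq_nonneg _)) hle (c2.mul_left 4)
  refine ⟨fun l => (sN l).of_norm, sL,
    (sL.tsum_le_tsum hle (c2.mul_left 4)).trans ?_⟩
  rw [tsum_mul_left]
  have hP : 0 ≤ ∑' n : ℤ, (bracket n ^ (-1 - σ)) ^ 2 := tsum_nonneg fun n => sq_nonneg _
  rw [tA, tB] at c3
  rw [mul_pow, mul_pow, convConst, mul_pow, Real.sq_sqrt hP]
  have : ∑' i, p i ^ 2 = ∑' n : ℤ, (bracket n ^ (-1 - σ)) ^ 2 := rfl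
  rw [this] at c3
  linarith

/-- The product `u f ∈ H^σ_c` of `u ∈ H^σ_c` and `f ∈ H^{1+σ}_c`, `-1/2 < σ ≤ 0`, given by
`(uf)^(l) = ∑ₖ û(l - k) f̂(k)`. -/
def mulOp {σ : ℝ} (h1 : -1 / 2 < σ) (h0 : σ ≤ 0) (u : Sobolev σ) :
    Sobolev (1 + σ) →L[ℂ] Sobolev σ :=
  LinearMap.mkContinuous
    { toFun := fun f => SeqSpace.mk (fun l => ∑' k : ℤ, coeff u (l - k) * coeff f k)
        (conv_estimate h1 h0 u f).2.1
      map_add' := by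
        intro f g
        ext l
        simp only [coeff_mk, map_add, Pi.add_apply, mul_add]
        exact ((conv_estimate h1 h0 u f).1 l).tsum_add ((conv_estimate h1 h0 u g).1 l)
      map_smul' := by
        intro c f
        ext l
        simp only [coeff_mk, map_smul, Pi.smul_apply, smul_eq_mul, RingHom.id_apply]
        rw [← tsum_mul_left]
        exact tsum_congr fun k => by ring }
    (convConst σ * ‖u‖) (by
      intro f
      have hC : 0 ≤ convConst σ := mul_nonneg (by norm_num) (Real.sqrt_nonneg _)
      refine abs_le_of_sq_le_sq' ?_ (by positivity) |>.2
      rw [norm_sq]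
      exact (conv_estimate h1 h0 u f).2.2)

/-- The Szegő projector `Π : H^σ_c → H^σ_+`. -/
def szego (σ : ℝ) : Sobolev σ →L[ℂ] Hardy σ :=
  (multiplier (fun n : ℤ => if 0 ≤ n then (1 : ℂ) else 0) 1 zero_le_one (by
    intro n
    have := (Real.rpow_pos_of_pos (bracket_pos n) σ).le
    split_ifs <;> simp [this])).codRestrict (Hardy σ) (by
    intro u n hn
    have : ¬ (0 ≤ n) := by omega
    simp [multiplier, this])

/-- The Toeplitz operator `T_u f = Π(u f)`, from `H^{1+σ}_+` to `H^σ_+`. -/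
def toeplitz {σ : ℝ} (h1 : -1 / 2 < σ) (h0 : σ ≤ 0) (u : Sobolev σ) :
    Hardy (1 + σ) →L[ℂ] Hardy σ :=
  szego σ ∘L mulOp h1 h0 u ∘L (Hardy (1 + σ)).subtypeL

/-- `D = -i∂ₓ`, from `H^{1+σ}_+` to `H^σ_+`. -/
def hardyD (σ : ℝ) : Hardy (1 + σ) →L[ℂ] Hardy σ :=
  (diffOp σ ∘L (Hardy (1 + σ)).subtypeL).codRestrict (Hardy σ) (by
    intro f n hn
    have := f.2 n hn
    simp [this])

/-- The inclusion of `H^{1+σ}_+` in `H^σ_+`. -/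
def hardyIncl (σ : ℝ) : Hardy (1 + σ) →L[ℂ] Hardy σ :=
  (incl (show σ ≤ 1 + σ by linarith) ∘L (Hardy (1 + σ)).subtypeL).codRestrict (Hardy σ) (by
    intro f n hn
    have := f.2 n hn
    simp [this])

/-! ### The Lax operator, the Riesz projectors and the functions `h_n` -/

/-- The Lax operator `L_u = D - T_u`, from its domain `H^{1+σ}_+` to `H^σ_+`. -/
def lax {σ : ℝ} (h1 : -1 / 2 < σ) (h0 : σ ≤ 0) (u : Sobolev σ) :
    Hardy (1 + σ) →L[ℂ] Hardy σ :=
  hardyD σ - toeplitz h1 h0 u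

/-- `σ(s) = min (s, 0)`. -/
def sig (s : ℝ) : ℝ := min s 0

lemma sig_gt {s : ℝ} (hs : -1 / 2 < s) : -1 / 2 < sig s := lt_min hs (by norm_num)

lemma sig_nonpos (s : ℝ) : sig s ≤ 0 := min_le_right _ _

lemma sig_le (s : ℝ) : sig s ≤ s := min_le_left _ _

/-- `L_u - λ : H^{1+σ}_+ → H^σ_+` for a potential `u ∈ H^s_{c,0}`, `s > -1/2`, `σ = min (s, 0)`. -/
def laxSub {s : ℝ} (hs : -1 / 2 < s) (u : Sobolev₀ s) (z : ℂ) :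
    Hardy (1 + sig s) →L[ℂ] Hardy (sig s) :=
  lax (sig_gt hs) (sig_nonpos s) (incl (sig_le s) u.1) - z • hardyIncl (sig s)

/-- The resolvent `(L_u - λ)⁻¹ ∈ 𝓛(H^σ_+, H^{1+σ}_+)`, for those `λ` for which it exists. -/
def laxResolvent {s : ℝ} (hs : -1 / 2 < s) (u : Sobolev₀ s) (z : ℂ) :
    Hardy (sig s) →L[ℂ] Hardy (1 + sig s) :=
  (laxSub hs u z).inverse

/-- The Riesz projector `P_n(u) = -(2πi)⁻¹ ∮_{|λ - n| = 1/3} (L_u - λ)⁻¹ dλ`. -/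
def rieszProj {s : ℝ} (hs : -1 / 2 < s) (n : ℕ) (u : Sobolev₀ s) :
    Hardy (sig s) →L[ℂ] Hardy (1 + sig s) :=
  -((2 * Real.pi * Complex.I : ℂ)⁻¹ • ∮ z in C((n : ℂ), 1 / 3), laxResolvent hs u z)

/-- `P_n(u)` is well defined: the circle `|λ - n| = 1/3` lies in the resolvent set of `L_u` and
the resolvent is integrable along it. -/
def RieszWellDefined {s : ℝ} (hs : -1 / 2 < s) (n : ℕ) (u : Sobolev₀ s) : Prop :=
  (∀ z ∈ Metric.sphere (n : ℂ) (1 / 3), (laxSub hs u z).IsInvertible) ∧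
    CircleIntegrable (laxResolvent hs u) (n : ℂ) (1 / 3)

/-- `h_n(u) = P_n(u) e_n ∈ H^{1+σ}_+`. -/
def hFun {s : ℝ} (hs : -1 / 2 < s) (n : ℕ) (u : Sobolev₀ s) : Hardy (1 + sig s) :=
  rieszProj hs n u (hardyExp (sig s) n)

end

end BenjaminOno

namespace BenjaminOno

noncomputable section

open SeqSpace

/-! ### The product of `H^s` and `H^{1+s}` -/

/-! Every spectral problem is recentred at its own eigenvalue. Write `λ = n + w` with `|w| = 1/3`
and multiply by `e_{-n}`. Then `(L_u - λ) f = g` becomes `(1 - A) f̃ = (D - w)⁻¹ g̃`, where `A = (D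
- w)⁻¹ T_u` on the frequencies `j ≥ -n` (`lax_sub_eq_iff`). The symbol `1/(j - w)` is at most
`3/⟨j⟩` and multiplication by `u` maps `H^{1+s}` to `H^s`, so `A` is bounded on `H^{1+s}` by a
multiple of `‖u‖_s`, uniformly in `n` and `w`.

All these `A` together form one element `lippmann hs u`, linear in `u`, of the Banach algebra of
bounded continuous families indexed by `n` and the angle of `w`. For small `u` the element `1 - A`
is invertible, and its inverse `N` is analytic in `u`, with uniformity in `n` built in.

The centred `e_n` is `e_0`, and `(D - w)⁻¹ e_0 = -w⁻¹ e_0`. This factor cancels against `dλ = i w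
dθ`, so the `j`-th coefficient of `h_n(u)` is the mean over the angle of the `(j - n)`-th
coefficient of `N e_0` (`coeff_hFun`). For `j = n` this is a bounded functional of `N`, equal to 1
at `N = 1`, which gives (ii).

For (i) take `j = 0`: the coefficient at `-n` of a vector that itself varies with `n`. Since `N = 1
+ A N` and `n ≥ 1`, only `A N e_0` contributes. The factor `(D - w)⁻¹` gains one power of `n`. A
bound on `‖u f‖_s` for each single `f` would not give summability along this diagonal. What does is
a Hilbert-Schmidt type estimate: the `l`-th coefficient of `u f` is at most `‖f‖` times a weighted
square summable sequence depending on `u` alone (`exists_conv_majorant`). -/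

lemma bracket_rpow_pos (n : ℤ) (δ : ℝ) : 0 < bracket n ^ δ :=
  Real.rpow_pos_of_pos (bracket_pos n) δ

lemma bracket_rpow_two_mul (n : ℤ) (δ : ℝ) : bracket n ^ (2 * δ) = (bracket n ^ δ) ^ 2 := by
  rw [mul_comm 2 δ, Real.rpow_mul (bracket_pos n).le]
  norm_num

lemma bracket_add_le (m n : ℤ) : bracket (m + n) ≤ 2 * bracket n * bracket m := by
  have h := bracket_sub_le m (-n)
  rw [sub_neg_eq_add, bracket_neg] at h
  nlinarith [one_le_bracket m, one_le_bracket n]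

/-- For `s ≤ 0` this is `kernel_le`. For `s ≥ 0` the weight is `⟨k⟩⁻¹`, and raising `⟨l⟩ ≤ 2⟨k⟩⟨l -
k⟩` to the power `s` suffices; the term in `⟨l⟩` is then only a surplus. -/
lemma exists_kernel_le {s : ℝ} (hs : -1 / 2 < s) : ∃ C : ℝ, 0 ≤ C ∧ ∀ l k : ℤ,
    bracket l ^ s ≤ C * (bracket k ^ (-1 - sig s) + bracket l ^ (-1 - sig s)) *
      (bracket (l - k) ^ s * bracket k ^ (1 + s)) := by
  rcases le_total s 0 with h0 | h0
  · refine ⟨2, by norm_num, fun l k => ?_⟩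
    rw [sig, min_eq_left h0]
    exact kernel_le hs h0 l k
  · refine ⟨2 ^ s, by positivity, fun l k => ?_⟩
    rw [sig, min_eq_right h0]
    have hl := bracket_add_le (l - k) k
    rw [sub_add_cancel] at hl
    have h1 := Real.rpow_le_rpow (bracket_pos l).le hl h0
    rw [Real.mul_rpow (by linarith [bracket_pos k]) (bracket_pos _).le,
      Real.mul_rpow (by norm_num) (bracket_pos k).le] at h1
    have h2 : bracket k ^ ((-1 : ℝ) - 0) * bracket k ^ (1 + s) = bracket k ^ s := by
      rw [← Real.rpow_add (bracket_pos k)]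
      ring_nf
    have h3 := bracket_rpow_pos l (-1 - 0)
    have h4 := bracket_rpow_pos (l - k) s
    have h5 := bracket_rpow_pos k (1 + s)
    calc bracket l ^ s ≤ 2 ^ s * bracket k ^ s * bracket (l - k) ^ s := h1
      _ = 2 ^ s * bracket k ^ ((-1 : ℝ) - 0) * (bracket (l - k) ^ s * bracket k ^ (1 + s)) := by
        rw [← h2]; ring
      _ ≤ _ := by gcongr; linarith

/-- The kernel `(p k + p l) a (l - k)` is square summable in `(k, l)` if `a` and `p` are. -/
lemma kernel_majorant {a p : ℤ → ℝ} (sa : Summable fun i => a i ^ 2)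
    (sp : Summable fun i => p i ^ 2) :
    (∀ l, Summable fun k => ((p k + p l) * a (l - k)) ^ 2) ∧
    (Summable fun l => ∑' k, ((p k + p l) * a (l - k)) ^ 2) ∧
    ∑' l, ∑' k, ((p k + p l) * a (l - k)) ^ 2 ≤ 4 * (∑' i, p i ^ 2) * ∑' i, a i ^ 2 := by
  have s0 : Summable fun x : ℤ × ℤ => a x.1 ^ 2 * p x.2 ^ 2 :=
    sa.mul_of_nonneg sp (fun i => sq_nonneg _) (fun i => sq_nonneg _)
  let e : ℤ × ℤ ≃ ℤ × ℤ :=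
    { toFun := fun x => (x.1 - x.2, x.2)
      invFun := fun x => (x.1 + x.2, x.2)
      left_inv := fun x => by simp
      right_inv := fun x => by simp }
  -- Two changes of variables, `(l, k) ↦ (l - k, k)` and `(l, k) ↦ (l - k, l)`, turn the terms with
  -- `p k` and with `p l` into products of independent sums.
  let e' : ℤ × ℤ ≃ ℤ × ℤ :=
    { toFun := fun x => (x.1 - x.2, x.1)
      invFun := fun x => (x.2, x.2 - x.1)
      left_inv := fun x => by simp
      right_inv := fun x => by simp }
  have t0 : ∑' x : ℤ × ℤ, a x.1 ^ 2 * p x.2 ^ 2 = (∑' i, a i ^ 2) * ∑' i, p i ^ 2 :=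
    (sa.tsum_mul_tsum sp s0).symm
  have s1 : Summable fun x : ℤ × ℤ => a (x.1 - x.2) ^ 2 * p x.2 ^ 2 :=
    ((e.summable_iff).2 s0).congr fun x => by simp [e]
  have s2 : Summable fun x : ℤ × ℤ => a (x.1 - x.2) ^ 2 * p x.1 ^ 2 :=
    ((e'.summable_iff).2 s0).congr fun x => by simp [e']
  have t1 : ∑' x : ℤ × ℤ, a (x.1 - x.2) ^ 2 * p x.2 ^ 2 = (∑' i, a i ^ 2) * ∑' i, p i ^ 2 := by
    rw [← t0, ← e.tsum_eq (fun x : ℤ × ℤ => a x.1 ^ 2 * p x.2 ^ 2)]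
    simp [e]
  have t2 : ∑' x : ℤ × ℤ, a (x.1 - x.2) ^ 2 * p x.1 ^ 2 = (∑' i, a i ^ 2) * ∑' i, p i ^ 2 := by
    rw [← t0, ← e'.tsum_eq (fun x : ℤ × ℤ => a x.1 ^ 2 * p x.2 ^ 2)]
    simp [e']
  have hle : ∀ x : ℤ × ℤ, ((p x.2 + p x.1) * a (x.1 - x.2)) ^ 2 ≤
      2 * (a (x.1 - x.2) ^ 2 * p x.2 ^ 2) + 2 * (a (x.1 - x.2) ^ 2 * p x.1 ^ 2) := fun x => by
    nlinarith [mul_nonneg (sq_nonneg (a (x.1 - x.2))) (sq_nonneg (p x.2 - p x.1))]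
  have sR := (s1.mul_left 2).add (s2.mul_left 2)
  have s3 : Summable fun x : ℤ × ℤ => ((p x.2 + p x.1) * a (x.1 - x.2)) ^ 2 :=
    Summable.of_nonneg_of_le (fun x => sq_nonneg _) hle sR
  refine ⟨fun l => s3.prod_factor l, s3.prod, ?_⟩
  rw [← s3.tsum_prod]
  refine (s3.tsum_le_tsum hle sR).trans_eq ?_
  rw [(s1.mul_left 2).tsum_add (s2.mul_left 2), tsum_mul_left, tsum_mul_left, t1, t2]
  ring

/-- The `l`-th coefficient of `u f` is controlled by `‖f‖` times a sequence depending on `u` only,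
which is square summable with weight `⟨l⟩^{2s}`. -/
lemma exists_conv_majorant {s : ℝ} (hs : -1 / 2 < s) : ∃ C : ℝ, 0 ≤ C ∧ ∀ u : Sobolev s,
    ∃ W : ℤ → ℝ, (∀ l, 0 ≤ W l) ∧ Summable W ∧ ∑' l, W l ≤ (C * ‖u‖) ^ 2 ∧
      ∀ (f : Sobolev (1 + s)) (l : ℤ),
        (Summable fun k : ℤ => coeff u (l - k) * coeff f k) ∧
        bracket l ^ (2 * s) * ‖∑' k : ℤ, coeff u (l - k) * coeff f k‖ ^ 2 ≤ W l * ‖f‖ ^ 2 := by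
  obtain ⟨K, hK, hker⟩ := exists_kernel_le hs
  let p : ℤ → ℝ := fun n => bracket n ^ (-1 - sig s)
  have sp : Summable fun i => p i ^ 2 := by
    have := sig_gt hs
    refine (summable_bracket (r := 2 * (1 + sig s)) (by linarith)).congr fun n => ?_
    simp only [p]
    rw [← bracket_rpow_two_mul]
    ring_nf
  have hP : 0 ≤ ∑' i, p i ^ 2 := tsum_nonneg fun i => sq_nonneg _
  refine ⟨K * (2 * √(∑' i, p i ^ 2)), by positivity, fun u => ?_⟩
  let a : ℤ → ℝ := fun n => bracket n ^ s * ‖coeff u n‖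
  have ha : ∀ i, 0 ≤ a i := fun i => mul_nonneg (bracket_rpow_pos _ _).le (norm_nonneg _)
  have hp : ∀ i, 0 ≤ p i := fun i => (bracket_rpow_pos _ _).le
  have ea : ∀ i, a i ^ 2 = bracket i ^ (2 * s) * ‖coeff u i‖ ^ 2 := fun i => by
    simp only [a]; rw [bracket_rpow_two_mul, mul_pow]
  have sa : Summable fun i => a i ^ 2 := by simpa only [ea] using summable_coeff u
  have tA : ∑' i, a i ^ 2 = ‖u‖ ^ 2 := by simp only [ea]; rw [norm_sq]
  obtain ⟨m1, m2, m3⟩ := kernel_majorant sa sp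
  refine ⟨fun l => K ^ 2 * ∑' k, ((p k + p l) * a (l - k)) ^ 2,
    fun l => mul_nonneg (sq_nonneg _) (tsum_nonneg fun _ => sq_nonneg _), m2.mul_left _, ?_,
    fun f l => ?_⟩
  · rw [tsum_mul_left, mul_pow, mul_pow, mul_pow, Real.sq_sqrt hP, ← tA]
    have := mul_le_mul_of_nonneg_left m3 (sq_nonneg K)
    linarith
  · let b : ℤ → ℝ := fun n => bracket n ^ (1 + s) * ‖coeff f n‖
    have hb : ∀ i, 0 ≤ b i := fun i => mul_nonneg (bracket_rpow_pos _ _).le (norm_nonneg _)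
    have eb : ∀ i, b i ^ 2 = bracket i ^ (2 * (1 + s)) * ‖coeff f i‖ ^ 2 := fun i => by
      simp only [b]; rw [bracket_rpow_two_mul, mul_pow]
    have sb : Summable fun i => b i ^ 2 := by simpa only [eb] using summable_coeff f
    have tB : ∑' i, b i ^ 2 = ‖f‖ ^ 2 := by simp only [eb]; rw [norm_sq]
    -- Cauchy-Schwarz in `k` puts all of `f` into `‖f‖`; the remaining factor depends only on `u`
    -- and `l`.
    obtain ⟨c1, c2⟩ := cauchy_schwarz
      (fun k => mul_nonneg (add_nonneg (hp k) (hp l)) (ha (l - k))) hb (m1 l) sb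
    have key : ∀ k : ℤ, bracket l ^ s * ‖coeff u (l - k) * coeff f k‖ ≤
        K * ((p k + p l) * a (l - k) * b k) := by
      intro k
      refine (mul_le_mul_of_nonneg_right (hker l k) (norm_nonneg _)).trans_eq ?_
      simp only [a, b, p, norm_mul]
      ring
    have wl := bracket_rpow_pos l s
    have sN : Summable fun k : ℤ => ‖coeff u (l - k) * coeff f k‖ := by
      refine Summable.of_nonneg_of_le (fun k => norm_nonneg _) (fun k => ?_)
        (c1.mul_left ((bracket l ^ s)⁻¹ * K))
      rw [mul_assoc, inv_mul_eq_div, le_div_iff₀ wl, mul_comm]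
      exact key k
    refine ⟨sN.of_norm, ?_⟩
    have h : bracket l ^ s * ‖∑' k : ℤ, coeff u (l - k) * coeff f k‖ ≤
        K * ∑' k, (p k + p l) * a (l - k) * b k := by
      refine (mul_le_mul_of_nonneg_left (norm_tsum_le_tsum_norm sN) wl.le).trans ?_
      rw [← tsum_mul_left, ← tsum_mul_left]
      exact (sN.mul_left _).tsum_le_tsum key (c1.mul_left K)
    have h2 := pow_le_pow_left₀ (mul_nonneg wl.le (norm_nonneg _)) h 2
    rw [bracket_rpow_two_mul, ← mul_pow, ← tB]
    refine h2.trans ?_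
    rw [mul_pow, mul_assoc]
    exact mul_le_mul_of_nonneg_left c2 (sq_nonneg K)

/-- A constant in the estimate `‖u f‖_s ≤ C ‖u‖_s ‖f‖_{1+s}`. -/
def mulConst {s : ℝ} (hs : -1 / 2 < s) : ℝ := (exists_conv_majorant hs).choose

lemma mulConst_nonneg {s : ℝ} (hs : -1 / 2 < s) : 0 ≤ mulConst hs :=
  (exists_conv_majorant hs).choose_spec.1

lemma conv_majorant {s : ℝ} (hs : -1 / 2 < s) (u : Sobolev s) :
    ∃ W : ℤ → ℝ, (∀ l, 0 ≤ W l) ∧ Summable W ∧ ∑' l, W l ≤ (mulConst hs * ‖u‖) ^ 2 ∧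
      ∀ (f : Sobolev (1 + s)) (l : ℤ),
        (Summable fun k : ℤ => coeff u (l - k) * coeff f k) ∧
        bracket l ^ (2 * s) * ‖∑' k : ℤ, coeff u (l - k) * coeff f k‖ ^ 2 ≤ W l * ‖f‖ ^ 2 :=
  (exists_conv_majorant hs).choose_spec.2 u

lemma summable_conv {s : ℝ} (hs : -1 / 2 < s) (u : Sobolev s) (f : Sobolev (1 + s)) (l : ℤ) :
    Summable fun k : ℤ => coeff u (l - k) * coeff f k :=
  (conv_majorant hs u).choose_spec.2.2.2 f l |>.1

/-- The product `(u, f) ↦ u f`, from `H^s × H^{1+s}` to `H^s`, `s > -1/2`. -/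
def mulBilin {s : ℝ} (hs : -1 / 2 < s) : Sobolev s →L[ℂ] Sobolev (1 + s) →L[ℂ] Sobolev s :=
  LinearMap.mkContinuous₂
    (LinearMap.mk₂ ℂ (fun (u : Sobolev s) (f : Sobolev (1 + s)) =>
      (SeqSpace.mk (fun l => ∑' k : ℤ, coeff u (l - k) * coeff f k) (by
        obtain ⟨W, h0, h1, -, h3⟩ := conv_majorant hs u
        exact Summable.of_nonneg_of_le
          (fun l => mul_nonneg (bracket_rpow_pos _ _).le (sq_nonneg _))
          (fun l => (h3 f l).2) (h1.mul_right _)) : Sobolev s))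
      (by
        intro u v f
        ext l
        simp only [coeff_mk, map_add, Pi.add_apply, add_mul]
        exact (summable_conv hs u f l).tsum_add (summable_conv hs v f l))
      (by
        intro c u f
        ext l
        simp only [coeff_mk, map_smul, Pi.smul_apply, smul_eq_mul]
        rw [← tsum_mul_left]
        exact tsum_congr fun k => by ring)
      (by
        intro u f g
        ext l
        simp only [coeff_mk, map_add, Pi.add_apply, mul_add]
        exact (summable_conv hs u f l).tsum_add (summable_conv hs u g l))
      (by
        intro c u f
        ext l
        simp only [coeff_mk, map_smul, Pi.smul_apply, smul_eq_mul]
        rw [← tsum_mul_left]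
        exact tsum_congr fun k => by ring))
    (mulConst hs) (by
      intro u f
      have := mulConst_nonneg hs
      refine abs_le_of_sq_le_sq' ?_ (by positivity) |>.2
      rw [norm_sq]
      obtain ⟨W, h0, h1, h2, h3⟩ := conv_majorant hs u
      have hs' := h1.mul_right (‖f‖ ^ 2)
      refine ((Summable.of_nonneg_of_le
          (fun l => mul_nonneg (bracket_rpow_pos _ _).le (sq_nonneg _))
          (fun l => (h3 f l).2) hs').tsum_le_tsum (fun l => (h3 f l).2) hs').trans ?_
      rw [tsum_mul_right, mul_pow _ ‖f‖]
      gcongr)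

lemma coeff_mulBilin {s : ℝ} (hs : -1 / 2 < s) (u : Sobolev s) (f : Sobolev (1 + s)) (l : ℤ) :
    coeff (mulBilin hs u f) l = ∑' k : ℤ, coeff u (l - k) * coeff f k := rfl

lemma norm_mulBilin_le {s : ℝ} (hs : -1 / 2 < s) (u : Sobolev s) :
    ‖mulBilin hs u‖ ≤ mulConst hs * ‖u‖ := by
  refine (mulBilin hs).le_of_opNorm_le ?_ u
  exact LinearMap.mkContinuous₂_norm_le _ (mulConst_nonneg hs) _

lemma norm_multiplier_le {β γ C : ℝ} (m : ℤ → ℂ) (hC : 0 ≤ C)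
    (hm : ∀ n, bracket n ^ γ * ‖m n‖ ≤ C * bracket n ^ β) : ‖multiplier m C hC hm‖ ≤ C :=
  ContinuousLinearMap.opNorm_le_bound _ hC fun u => by
    refine abs_le_of_sq_le_sq' ?_ (by positivity) |>.2
    rw [norm_sq, mul_pow]
    exact (multiplier_summable_norm m hm u).2

/-! ### Bounded families of operators -/

/-- The Banach algebra of the bounded continuous families of operators on `E`, indexed by `n` and
an angle. -/
def OperatorFamily (E : Type) [NormedAddCommGroup E] [NormedSpace ℂ E] : Type :=
  BoundedContinuousFunction (ℕ × ℝ) (E →L[ℂ] E)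

namespace OperatorFamily

variable {E : Type} [NormedAddCommGroup E] [NormedSpace ℂ E]

instance : NormedRing (OperatorFamily E) :=
  inferInstanceAs (NormedRing (BoundedContinuousFunction (ℕ × ℝ) (E →L[ℂ] E)))

instance : NormedAlgebra ℂ (OperatorFamily E) :=
  inferInstanceAs (NormedAlgebra ℂ (BoundedContinuousFunction (ℕ × ℝ) (E →L[ℂ] E)))

instance [CompleteSpace E] : CompleteSpace (OperatorFamily E) :=
  inferInstanceAs (CompleteSpace (BoundedContinuousFunction (ℕ × ℝ) (E →L[ℂ] E)))

/-- The member of index `t` of a family. -/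
def eval (R : OperatorFamily E) (t : ℕ × ℝ) : E →L[ℂ] E :=
  (show BoundedContinuousFunction (ℕ × ℝ) (E →L[ℂ] E) from R) t

/-- A bounded continuous family. -/
def mk (f : ℕ × ℝ → E →L[ℂ] E) (hf : Continuous f) (C : ℝ) (hC : ∀ t, ‖f t‖ ≤ C) :
    OperatorFamily E :=
  BoundedContinuousFunction.ofNormedAddCommGroup f hf C hC

lemma norm_mk_le {f : ℕ × ℝ → E →L[ℂ] E} (hf : Continuous f) {C : ℝ} (h0 : 0 ≤ C)
    (hC : ∀ t, ‖f t‖ ≤ C) : ‖mk f hf C hC‖ ≤ C :=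
  BoundedContinuousFunction.norm_ofNormedAddCommGroup_le hf h0 hC

lemma ext {R S : OperatorFamily E} (h : ∀ t, R.eval t = S.eval t) : R = S :=
  BoundedContinuousFunction.ext h

lemma eval_add (R S : OperatorFamily E) (t : ℕ × ℝ) :
    (R + S).eval t = R.eval t + S.eval t := rfl

lemma eval_smul (c : ℂ) (R : OperatorFamily E) (t : ℕ × ℝ) :
    (c • R).eval t = c • R.eval t := rfl

lemma eval_one (t : ℕ × ℝ) : (1 : OperatorFamily E).eval t = 1 := rfl

lemma norm_eval_le (R : OperatorFamily E) (t : ℕ × ℝ) : ‖R.eval t‖ ≤ ‖R‖ :=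
  BoundedContinuousFunction.norm_coe_le_norm _ t

lemma continuous_eval (R : OperatorFamily E) : Continuous R.eval :=
  BoundedContinuousFunction.continuous _

end OperatorFamily

/-! ### The free resolvent, in coordinates centred at the eigenvalue `n` -/

/-- The translation `û(j) ↦ û(j + n)`, that is multiplication by `e_{-n}`. -/
def shift {β : ℝ} (n : ℤ) (f : Sobolev β) : Sobolev β :=
  SeqSpace.mk (fun j => coeff f (j + n)) (by
    -- The comparison constant grows with `n`. This is harmless: translation only transports
    -- solutions, and its norm never enters an estimate.
    have h := (Equiv.addRight n).summable_iff.2 (summable_coeff f)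
    refine Summable.of_nonneg_of_le
      (fun j => mul_nonneg (bracket_rpow_pos _ _).le (sq_nonneg _)) (fun j => ?_)
      (h.mul_left ((2 * bracket n) ^ |2 * β|))
    simp only [Function.comp_apply, Equiv.coe_addRight]
    rw [← mul_assoc]
    refine mul_le_mul_of_nonneg_right ?_ (sq_nonneg _)
    have hn := one_le_bracket n
    have hj := bracket_pos j
    have hjn := bracket_pos (j + n)
    rcases le_total 0 (2 * β) with hβ | hβ
    · rw [abs_of_nonneg hβ, ← Real.mul_rpow (by linarith) hjn.le]
      refine Real.rpow_le_rpow hj.le ?_ hβ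
      have := bracket_add_le (j + n) (-n)
      rwa [bracket_neg, add_neg_cancel_right] at this
    · rw [abs_of_nonpos hβ, Real.rpow_neg (by linarith), ← div_eq_inv_mul,
        le_div_iff₀ (Real.rpow_pos_of_pos (by linarith) _), mul_comm,
        ← Real.mul_rpow (by linarith) hj.le]
      exact Real.rpow_le_rpow_of_nonpos hjn (bracket_add_le j n) hβ)

@[simp] lemma coeff_shift {β : ℝ} (n : ℤ) (f : Sobolev β) (j : ℤ) :
    coeff (shift n f) j = coeff f (j + n) := rfl

/-- The point of angle `θ` on the circle `|w| = 1/3`. -/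
def circlePt (θ : ℝ) : ℂ := circleMap 0 (1 / 3) θ

lemma norm_circlePt (θ : ℝ) : ‖circlePt θ‖ = 1 / 3 := by
  rw [circlePt, norm_circleMap_zero]
  norm_num

lemma continuous_circlePt : Continuous circlePt := continuous_circleMap 0 (1 / 3)

/-- Equality at `j = 0`, where the distance is the radius `1/3`; otherwise `|j| ≤ 3(|j| - 1/3)`
because `|j| ≥ 1`. This is the source of the uniform constant 3. -/
lemma bracket_le_norm_sub (j : ℤ) (θ : ℝ) : bracket j ≤ 3 * ‖(j : ℂ) - circlePt θ‖ := by
  rcases eq_or_ne j 0 with rfl | hj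
  · simp [norm_circlePt, bracket]
  · have h1 : (1 : ℝ) ≤ |(j : ℝ)| := by
      have := Int.one_le_abs hj
      exact_mod_cast this
    have h2 := norm_sub_norm_le (j : ℂ) (circlePt θ)
    rw [norm_circlePt, Complex.norm_intCast] at h2
    rw [bracket, max_eq_right h1]
    linarith

lemma sub_circlePt_ne (j : ℤ) (θ : ℝ) : (j : ℂ) - circlePt θ ≠ 0 := by
  have h := bracket_le_norm_sub j θ
  have := bracket_pos j
  exact norm_pos_iff.1 (by linarith)

lemma norm_sub_inv_le (j : ℤ) (θ : ℝ) : ‖((j : ℂ) - circlePt θ)⁻¹‖ * bracket j ≤ 3 := by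
  rw [norm_inv, inv_mul_eq_div, div_le_iff₀ (norm_pos_iff.2 (sub_circlePt_ne j θ))]
  exact bracket_le_norm_sub j θ

/-- The symbol of `(D - w)⁻¹` truncated to the frequencies `j ≥ -n`. -/
def freeSymbol (n : ℕ) (θ : ℝ) (j : ℤ) : ℂ :=
  if -(n : ℤ) ≤ j then ((j : ℂ) - circlePt θ)⁻¹ else 0

lemma norm_freeSymbol_le (n : ℕ) (θ : ℝ) (j : ℤ) : ‖freeSymbol n θ j‖ * bracket j ≤ 3 := by
  rw [freeSymbol]
  split_ifs
  · exact norm_sub_inv_le j θ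
  · simp

/-- `(D - w)⁻¹` on the frequencies `j ≥ -n`, for the point `w` of angle `θ` on `|w| = 1/3`. -/
def freeRes (s : ℝ) (n : ℕ) (θ : ℝ) : Sobolev s →L[ℂ] Sobolev (1 + s) :=
  multiplier (freeSymbol n θ) 3 (by norm_num) (by
    intro j
    have h1 := norm_freeSymbol_le n θ j
    rw [Real.rpow_add (bracket_pos j), Real.rpow_one]
    nlinarith [bracket_rpow_pos j s])

lemma coeff_freeRes (s : ℝ) (n : ℕ) (θ : ℝ) (f : Sobolev s) (j : ℤ) :
    coeff (freeRes s n θ f) j = freeSymbol n θ j * coeff f j := rfl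

lemma norm_freeRes_le (s : ℝ) (n : ℕ) (θ : ℝ) : ‖freeRes s n θ‖ ≤ 3 :=
  norm_multiplier_le _ _ _

/-- The resolvent identity: of the two factors `1/(j - w)`, one pays for the extra derivative and
the other is merely bounded by 3. -/
lemma norm_freeRes_sub_le (s : ℝ) (n : ℕ) (θ φ : ℝ) :
    ‖freeRes s n θ - freeRes s n φ‖ ≤ 9 * ‖circlePt θ - circlePt φ‖ := by
  have hC : 0 ≤ 9 * ‖circlePt θ - circlePt φ‖ := by positivity
  have e : freeRes s n θ - freeRes s n φ = multiplier
      (fun j => freeSymbol n θ j - freeSymbol n φ j) (9 * ‖circlePt θ - circlePt φ‖) hC (by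
        intro j
        have h1 : ‖freeSymbol n θ j - freeSymbol n φ j‖ * bracket j ≤
            9 * ‖circlePt θ - circlePt φ‖ := by
          simp only [freeSymbol]
          split_ifs
          · rw [inv_sub_inv (sub_circlePt_ne j θ) (sub_circlePt_ne j φ), sub_sub_sub_cancel_left,
              div_eq_mul_inv, norm_mul, mul_inv, norm_mul]
            have a1 := norm_sub_inv_le j θ
            have a2 := norm_sub_inv_le j φ
            have a3 : ‖((j : ℂ) - circlePt φ)⁻¹‖ ≤ 3 := by
              nlinarith [one_le_bracket j, norm_nonneg ((j : ℂ) - circlePt φ)⁻¹]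
            calc _ = ‖circlePt θ - circlePt φ‖ * ((‖((j : ℂ) - circlePt θ)⁻¹‖ * bracket j) *
                  ‖((j : ℂ) - circlePt φ)⁻¹‖) := by ring
              _ ≤ ‖circlePt θ - circlePt φ‖ * (3 * 3) := by gcongr
              _ = _ := by ring
          · simp
        rw [Real.rpow_add (bracket_pos j), Real.rpow_one]
        nlinarith [bracket_rpow_pos j s]) := by
    ext f j
    exact (sub_mul _ _ _).symm
  rw [e]
  exact norm_multiplier_le _ _ _

lemma continuous_freeRes (s : ℝ) (n : ℕ) : Continuous (freeRes s n) := by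
  rw [continuous_iff_continuousAt]
  intro φ
  rw [ContinuousAt, tendsto_iff_norm_sub_tendsto_zero]
  have h : Filter.Tendsto (fun θ => 9 * ‖circlePt θ - circlePt φ‖) (nhds φ) (nhds 0) := by
    have : Continuous fun θ => 9 * ‖circlePt θ - circlePt φ‖ := by
      have := continuous_circlePt
      fun_prop
    simpa using this.tendsto φ
  exact squeeze_zero (fun _ => norm_nonneg _) (fun θ => norm_freeRes_sub_le s n θ φ) h

lemma continuous_freeRes_comp {s : ℝ} (T : Sobolev (1 + s) →L[ℂ] Sobolev s) :
    Continuous fun t : ℕ × ℝ => freeRes s t.1 t.2 ∘L T :=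
  continuous_prod_of_discrete_left.2 fun n =>
    (continuous_freeRes s n).clm_comp continuous_const

lemma norm_freeRes_comp_le {s : ℝ} (T : Sobolev (1 + s) →L[ℂ] Sobolev s) (t : ℕ × ℝ) :
    ‖freeRes s t.1 t.2 ∘L T‖ ≤ 3 * ‖T‖ :=
  (ContinuousLinearMap.opNorm_comp_le _ _).trans
    (mul_le_mul_of_nonneg_right (norm_freeRes_le s t.1 t.2) (norm_nonneg _))

/-- The operators `(D - w)⁻¹ T`, as a bounded family indexed by `n` and the angle of `w`. -/
def freeResComp {s : ℝ} (T : Sobolev (1 + s) →L[ℂ] Sobolev s) :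
    OperatorFamily (Sobolev (1 + s)) :=
  OperatorFamily.mk (fun t => freeRes s t.1 t.2 ∘L T)
    (continuous_freeRes_comp T) (3 * ‖T‖) (norm_freeRes_comp_le T)

lemma eval_freeResComp {s : ℝ} (T : Sobolev (1 + s) →L[ℂ] Sobolev s) (t : ℕ × ℝ) :
    (freeResComp T).eval t = freeRes s t.1 t.2 ∘L T := rfl

lemma norm_freeResComp_le {s : ℝ} (T : Sobolev (1 + s) →L[ℂ] Sobolev s) :
    ‖freeResComp T‖ ≤ 3 * ‖T‖ :=
  OperatorFamily.norm_mk_le _ (by positivity) _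

/-- The operators `f ↦ (D - w)⁻¹ Π (u f)`, centred at `n`, as a bounded family indexed by `n` and
the angle of `w`, which depends linearly on `u`. -/
def lippmann {s : ℝ} (hs : -1 / 2 < s) :
    Sobolev s →L[ℂ] OperatorFamily (Sobolev (1 + s)) :=
  LinearMap.mkContinuous
    { toFun := fun u => freeResComp (mulBilin hs u)
      map_add' := by
        intro u v
        refine OperatorFamily.ext fun t => ?_
        rw [OperatorFamily.eval_add, eval_freeResComp, eval_freeResComp,
          eval_freeResComp, map_add, ContinuousLinearMap.comp_add]
      map_smul' := by
        intro c u
        refine OperatorFamily.ext fun t => ?_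
        rw [RingHom.id_apply, OperatorFamily.eval_smul, eval_freeResComp,
          eval_freeResComp, map_smul, ContinuousLinearMap.comp_smul] }
    (3 * mulConst hs) (by
      intro u
      refine (norm_freeResComp_le _).trans ?_
      have := norm_mulBilin_le hs u
      linarith)

lemma eval_lippmann {s : ℝ} (hs : -1 / 2 < s) (u : Sobolev s) (t : ℕ × ℝ) :
    (lippmann hs u).eval t = freeRes s t.1 t.2 ∘L mulBilin hs u := rfl

/-- The coefficient formula does not see the regularity. Hence a solution found in `H^{1+s}` also
solves the equation in `H^{1+σ}`, where the Lax operator is defined. -/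
lemma lippmann_incl {s σ : ℝ} (hs : -1 / 2 < s) (hσ : -1 / 2 < σ) (h : σ ≤ s)
    (h' : 1 + σ ≤ 1 + s) (u : Sobolev s) (t : ℕ × ℝ) (f : Sobolev (1 + s)) :
    (lippmann hσ (incl h u)).eval t (incl h' f) = incl h' ((lippmann hs u).eval t f) := by
  ext j
  simp [eval_lippmann, coeff_freeRes, coeff_mulBilin]

/-! ### The resolvent equation -/

lemma coeff_hardyD {σ : ℝ} (f : Hardy (1 + σ)) (l : ℤ) :
    coeff (hardyD σ f).1 l = l * coeff f.1 l := rfl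

lemma coeff_hardyIncl {σ : ℝ} (f : Hardy (1 + σ)) (l : ℤ) :
    coeff (hardyIncl σ f).1 l = coeff f.1 l := one_mul _

lemma coeff_toeplitz {σ : ℝ} (h1 : -1 / 2 < σ) (h0 : σ ≤ 0) (u : Sobolev σ) (f : Hardy (1 + σ))
    (l : ℤ) : coeff (toeplitz h1 h0 u f).1 l =
      (if 0 ≤ l then 1 else 0) * ∑' k : ℤ, coeff u (l - k) * coeff f.1 k := rfl

/-- At frequency `l = j + n ≥ 0` one equation is the other divided by `j - w`. At `l < 0` both hold
trivially, since `f` and `g` lie in the Hardy space and the symbol is cut off there. -/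
lemma lax_sub_eq_iff {σ : ℝ} (h1 : -1 / 2 < σ) (h0 : σ ≤ 0) (u : Sobolev σ) (n : ℕ) (θ : ℝ)
    (f : Hardy (1 + σ)) (g : Hardy σ) :
    (lax h1 h0 u - circleMap n (1 / 3) θ • hardyIncl σ) f = g ↔
      (1 - (lippmann h1 u).eval (n, θ)) (shift n f.1) = freeRes σ n θ (shift n g.1) := by
  have hz : circleMap (n : ℂ) (1 / 3) θ = n + circlePt θ := by simp [circlePt, circleMap]
  have hL : ∀ l : ℤ, coeff ((lax h1 h0 u - circleMap n (1 / 3) θ • hardyIncl σ) f).1 l =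
      l * coeff f.1 l - (if 0 ≤ l then 1 else 0) * (∑' k : ℤ, coeff u (l - k) * coeff f.1 k) -
        (n + circlePt θ) * coeff f.1 l := by
    intro l
    rw [← hz]
    rw [← coeff_hardyD, ← coeff_toeplitz h1 h0, ← coeff_hardyIncl (σ := σ)]
    rfl
  have hshift : ∀ j : ℤ, ∑' k : ℤ, coeff u (j - k) * coeff (shift n f.1) k =
      ∑' k : ℤ, coeff u (j + n - k) * coeff f.1 k := by
    intro j
    rw [← (Equiv.addRight (n : ℤ)).tsum_eq fun k : ℤ => coeff u (j + n - k) * coeff f.1 k]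
    simp
  have hR : ∀ j : ℤ, coeff ((1 - (lippmann h1 u).eval (n, θ)) (shift n f.1)) j = coeff f.1 (j + n) -
      freeSymbol n θ j * ∑' k : ℤ, coeff u (j + n - k) * coeff f.1 k := by
    intro j
    rw [← hshift]
    rfl
  constructor
  · intro h
    ext j
    rw [hR, coeff_freeRes, coeff_shift, ← h, hL, freeSymbol]
    split_ifs with hj hj' hj'
    · have := sub_circlePt_ne j θ
      field_simp
      push_cast
      ring
    · omega
    · omega
    · have := f.2 (j + n) (by omega)
      simp [this]
  · intro h
    refine Subtype.ext (SeqSpace.ext fun l => ?_)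
    have hl := congrArg (fun v => coeff v (l - n)) h
    rw [hR, coeff_freeRes, coeff_shift, sub_add_cancel, freeSymbol] at hl
    rw [hL]
    split_ifs with hj
    · rw [if_pos (by omega)] at hl
      have := sub_circlePt_ne (l - n) θ
      push_cast at this hl
      field_simp at hl
      rw [← hl]
      ring
    · have h1 := f.2 l (by omega)
      have h2 := g.2 l (by omega)
      simp [h1, h2]

/-! ### The Neumann series -/

/-- The inverses of `1 - (D - w)⁻¹ T_u`, centred at `n`. -/
def neumann {s : ℝ} (hs : -1 / 2 < s) (u : Sobolev s) :
    OperatorFamily (Sobolev (1 + s)) :=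
  Ring.inverse (1 - lippmann hs u)

section neumann

variable {s : ℝ} {hs : -1 / 2 < s} {u : Sobolev s}

lemma neumann_mul (hu : ‖lippmann hs u‖ < 1) : neumann hs u * (1 - lippmann hs u) = 1 :=
  Ring.inverse_mul_cancel _ (isUnit_one_sub_of_norm_lt_one hu)

lemma mul_neumann (hu : ‖lippmann hs u‖ < 1) : (1 - lippmann hs u) * neumann hs u = 1 :=
  Ring.mul_inverse_cancel _ (isUnit_one_sub_of_norm_lt_one hu)

lemma neumann_eq (hu : ‖lippmann hs u‖ < 1) :
    neumann hs u = 1 + lippmann hs u * neumann hs u := by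
  have := mul_neumann hu
  rw [sub_mul, one_mul] at this
  rw [← this]
  abel

lemma neumann_apply_apply (hu : ‖lippmann hs u‖ < 1) (t : ℕ × ℝ) (f : Sobolev (1 + s)) :
    (neumann hs u).eval t ((1 - (lippmann hs u).eval t) f) = f :=
  congrArg (fun R => R f) (congrArg (fun R => OperatorFamily.eval R t) (neumann_mul hu))

lemma apply_neumann_apply (hu : ‖lippmann hs u‖ < 1) (t : ℕ × ℝ) (f : Sobolev (1 + s)) :
    (1 - (lippmann hs u).eval t) ((neumann hs u).eval t f) = f :=
  congrArg (fun R => R f) (congrArg (fun R => OperatorFamily.eval R t) (mul_neumann hu))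

/-- With `x = ‖lippmann hs u‖`, the identity `N - 1 = A + A (N - 1)` gives `‖N - 1‖ ≤ x / (1 - x)`,
which is at most `1/2` for `x < 1/3`. -/
lemma norm_neumann_sub_one_le (hu : ‖lippmann hs u‖ < 1 / 3) : ‖neumann hs u - 1‖ ≤ 1 / 2 := by
  have h : neumann hs u - 1 = lippmann hs u + lippmann hs u * (neumann hs u - 1) := by
    rw [mul_sub, mul_one, add_sub_cancel, sub_eq_iff_eq_add']
    exact neumann_eq (by linarith)
  have h1 : ‖neumann hs u - 1‖ ≤ ‖lippmann hs u‖ + ‖lippmann hs u‖ * ‖neumann hs u - 1‖ := by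
    conv_lhs => rw [h]
    exact (norm_add_le _ _).trans (by gcongr; exact norm_mul_le _ _)
  nlinarith [norm_nonneg (neumann hs u - 1)]

lemma analyticAt_neumann (hu : ‖lippmann hs u‖ < 1) : AnalyticAt ℂ (neumann hs) u := by
  have h := analyticAt_inverse (𝕜 := ℂ) (isUnit_one_sub_of_norm_lt_one hu).unit
  exact AnalyticAt.comp (g := Ring.inverse) (f := fun v => 1 - lippmann hs v) h
    (analyticAt_const.sub ((lippmann hs).analyticAt u))

end neumann

/-! ### The resolvent of the Lax operator near the circles -/

/-- A solution of the centred equation is supported on the frequencies `j ≥ -n`. -/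
lemma shift_neumann_mem_hardy {s σ : ℝ} {hs : -1 / 2 < s} {u : Sobolev s}
    (hu : ‖lippmann hs u‖ < 1) (h : 1 + σ ≤ 1 + s) (n : ℕ) (θ : ℝ) (g : Sobolev s) :
    shift (-n) (incl h ((neumann hs u).eval (n, θ) (freeRes s n θ g))) ∈ Hardy (1 + σ) := by
  intro l hl
  have hf := apply_neumann_apply hu (n, θ) (freeRes s n θ g)
  set f := (neumann hs u).eval (n, θ) (freeRes s n θ g)
  have hc := congrArg (fun v => coeff v (l + -n)) (sub_eq_iff_eq_add.1 hf)
  -- Both terms of `f = (D - w)⁻¹ g + A f` carry the cut-off symbol, which vanishes below `-n`.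
  have h0 : freeSymbol n θ (l + -n) = 0 := if_neg (by omega)
  simpa [eval_lippmann, coeff_freeRes, h0] using hc

lemma shift_shift_neg {β : ℝ} (n : ℤ) (f : Sobolev β) : shift n (shift (-n) f) = f := by
  ext j
  simp

lemma shift_neg_shift {β : ℝ} (n : ℤ) (f : Sobolev β) : shift (-n) (shift n f) = f := by
  ext j
  simp

lemma incl_self {β : ℝ} (f : Sobolev β) : incl le_rfl f = f := by
  ext j
  simp

lemma shift_zero {β : ℝ} (n : ℤ) : shift n (0 : Sobolev β) = 0 := by
  ext j
  simp

lemma lax_sub_isInvertible {σ : ℝ} (h1 : -1 / 2 < σ) (h0 : σ ≤ 0) {u : Sobolev σ}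
    (hu : ‖lippmann h1 u‖ < 1) (n : ℕ) (θ : ℝ) :
    (lax h1 h0 u - circleMap n (1 / 3) θ • hardyIncl σ).IsInvertible := by
  refine ⟨ContinuousLinearEquiv.ofBijective
    (lax h1 h0 u - circleMap n (1 / 3) θ • hardyIncl σ) ?_ ?_,
    ContinuousLinearEquiv.coe_ofBijective _ _ _⟩
  · rw [LinearMap.ker_eq_bot']
    intro f hf
    have h := (lax_sub_eq_iff h1 h0 u n θ f 0).1 hf
    have h2 := neumann_apply_apply hu (n, θ) (shift n f.1)
    rw [h, Submodule.coe_zero, shift_zero, map_zero, map_zero] at h2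
    refine Subtype.ext ?_
    rw [← shift_neg_shift n f.1, ← h2, shift_zero, Submodule.coe_zero]
  · rw [LinearMap.range_eq_top]
    intro g
    refine ⟨⟨_, shift_neumann_mem_hardy hu le_rfl n θ (shift n g.1)⟩, ?_⟩
    refine (lax_sub_eq_iff h1 h0 u n θ _ g).2 ?_
    rw [shift_shift_neg, incl_self]
    exact apply_neumann_apply hu (n, θ) _

/-- The neighbourhood of zero on which the Neumann series converge. -/
def goodSet {s : ℝ} (hs : -1 / 2 < s) : Set (Sobolev₀ s) :=
  -- The first bound controls the Neumann series at regularity `s`, with `1/3` chosen to give the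
  -- lower bound in (ii). The second makes `L_u - λ` bijective at regularity `σ`.
  {u | ‖lippmann hs u.1‖ < 1 / 3 ∧ ‖lippmann (sig_gt hs) (incl (sig_le s) u.1)‖ < 1}

lemma isOpen_goodSet {s : ℝ} (hs : -1 / 2 < s) : IsOpen (goodSet hs) := by
  have h1 : Continuous fun u : Sobolev₀ s => ‖lippmann hs u.1‖ :=
    ((lippmann hs).continuous.comp continuous_subtype_val).norm
  have h2 : Continuous fun u : Sobolev₀ s => ‖lippmann (sig_gt hs) (incl (sig_le s) u.1)‖ :=
    ((lippmann (sig_gt hs)).continuous.comp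
      ((incl (sig_le s)).continuous.comp continuous_subtype_val)).norm
  exact (isOpen_lt h1 continuous_const).inter (isOpen_lt h2 continuous_const)

lemma zero_mem_goodSet {s : ℝ} (hs : -1 / 2 < s) : 0 ∈ goodSet hs := by
  simp [goodSet]

lemma exists_circleMap_eq {n : ℕ} {z : ℂ} (hz : z ∈ Metric.sphere (n : ℂ) (1 / 3)) :
    ∃ θ, circleMap (n : ℂ) (1 / 3) θ = z := by
  have := range_circleMap (n : ℂ) (1 / 3)
  rw [abs_of_pos (by norm_num)] at this
  rwa [← this] at hz

lemma laxSub_isInvertible {s : ℝ} (hs : -1 / 2 < s) {u : Sobolev₀ s} (hu : u ∈ goodSet hs) {n : ℕ}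
    {z : ℂ} (hz : z ∈ Metric.sphere (n : ℂ) (1 / 3)) : (laxSub hs u z).IsInvertible := by
  obtain ⟨θ, rfl⟩ := exists_circleMap_eq hz
  exact lax_sub_isInvertible (sig_gt hs) (sig_nonpos s) hu.2 n θ

lemma rieszWellDefined {s : ℝ} (hs : -1 / 2 < s) {u : Sobolev₀ s} (hu : u ∈ goodSet hs) (n : ℕ) :
    RieszWellDefined hs n u := by
  refine ⟨fun z hz => laxSub_isInvertible hs hu hz, ?_⟩
  refine ContinuousOn.circleIntegrable (by norm_num) fun z hz => ?_
  have hc : Continuous (laxSub hs u) := by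
    unfold laxSub
    fun_prop
  -- Inversion is continuous at invertible operators, so the resolvent is continuous, hence
  -- integrable, on the circle.
  have := ((laxSub_isInvertible hs hu hz).contDiffAt_map_inverse (n := 0)).continuousAt
  exact (ContinuousAt.comp (f := laxSub hs u) this hc.continuousAt).continuousWithinAt

lemma shift_expFun {β : ℝ} (n : ℤ) : shift n (expFun β n) = expFun β 0 := by
  ext j
  simp [expFun, Pi.single_apply]

lemma freeRes_expFun (s : ℝ) (n : ℕ) (θ : ℝ) :
    freeRes s n θ (expFun s 0) = (-(circlePt θ)⁻¹) • expFun (1 + s) 0 := by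
  ext j
  rw [coeff_freeRes, map_smul]
  rcases eq_or_ne j 0 with rfl | hj
  · simp [expFun, freeSymbol, inv_neg]
  · simp [expFun, hj]

/-- The Neumann solution at regularity `s`, translated back and included in `H^{1+σ}`, solves `(L_u
- λ) f = e_n`. By invertibility at regularity `σ` it is the resolvent applied to `e_n`. -/
lemma coeff_laxResolvent {s : ℝ} (hs : -1 / 2 < s) {u : Sobolev₀ s} (hu : u ∈ goodSet hs) (n : ℕ)
    (θ : ℝ) (j : ℤ) :
    coeff (laxResolvent hs u (circleMap n (1 / 3) θ) (hardyExp (sig s) n)).1 j =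
      -(circlePt θ)⁻¹ * coeff ((neumann hs u.1).eval (n, θ) (expFun (1 + s) 0)) (j - n) := by
  have hu1 : ‖lippmann hs u.1‖ < 1 := by linarith [hu.1]
  have hle : 1 + sig s ≤ 1 + s := by linarith [sig_le s]
  have hmem := shift_neumann_mem_hardy hu1 hle n θ (expFun s 0)
  have hsol : laxSub hs u (circleMap n (1 / 3) θ) ⟨_, hmem⟩ = hardyExp (sig s) n := by
    refine (lax_sub_eq_iff (sig_gt hs) (sig_nonpos s) _ n θ _ _).2 ?_
    rw [shift_shift_neg, sub_apply, lippmann_incl hs,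
      one_apply_eq_self, ← map_sub]
    have h := apply_neumann_apply hu1 (n, θ) (freeRes s n θ (expFun s 0))
    rw [sub_apply, one_apply_eq_self] at h
    rw [h]
    have e : shift n (hardyExp (sig s) n).1 = expFun (sig s) 0 := shift_expFun (n : ℤ)
    rw [e, freeRes_expFun, freeRes_expFun]
    ext j
    simp [expFun]
  have hinv := laxSub_isInvertible hs hu
    (circleMap_mem_sphere (n : ℂ) (by norm_num : (0 : ℝ) ≤ 1 / 3) θ)
  rw [laxResolvent, ← hsol, hinv.inverse_apply_eq.2 rfl]
  change coeff (shift (-n) (incl hle ((neumann hs u.1).eval (n, θ)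
    (freeRes s n θ (expFun s 0))))) j = _
  rw [freeRes_expFun, map_smul]
  simp [sub_eq_add_neg]

/-! ### The coefficients of `h_n` as contour averages -/

/-- `u ↦ û(i)` as a bounded functional. -/
def coeffL {ι : Type} {k : ι → ℤ} {β : ℝ} (i : ι) : SeqSpace k β →L[ℂ] ℂ :=
  ⟨(LinearMap.proj i).comp coeff, continuous_coeff i⟩

lemma norm_expFun_zero (β : ℝ) : ‖expFun β 0‖ = 1 := by
  rw [norm_eq, tsum_eq_single 0 fun n hn => by simp [expFun, hn]]
  simp [expFun, bracket]

section average

variable {β : ℝ} (n : ℕ) (j : ℤ)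

lemma continuous_coeff_apply (R : OperatorFamily (Sobolev β)) :
    Continuous fun θ : ℝ => coeff (R.eval (n, θ) (expFun β 0)) j := by
  have h : Continuous fun θ : ℝ => R.eval (n, θ) :=
    R.continuous_eval.comp (continuous_const.prodMk continuous_id)
  exact (continuous_coeff j).comp (h.clm_apply continuous_const)

lemma norm_average_le {g : ℝ → ℂ} {c : ℝ} (h : ∀ θ, ‖g θ‖ ≤ c) :
    ‖(2 * Real.pi : ℂ)⁻¹ * ∫ θ in (0 : ℝ)..2 * Real.pi, g θ‖ ≤ c := by
  have hpi := Real.pi_pos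
  have h1 := intervalIntegral.norm_integral_le_of_norm_le_const (a := 0) (b := 2 * Real.pi)
    (f := g) (C := c) fun θ _ => h θ
  rw [sub_zero, abs_of_pos (by positivity)] at h1
  have h2 : ‖(2 * Real.pi : ℂ)⁻¹‖ = (2 * Real.pi)⁻¹ := by
    rw [norm_inv, norm_mul, Complex.norm_real, Real.norm_of_nonneg hpi.le]
    simp
  rw [norm_mul, h2, inv_mul_eq_div, div_le_iff₀ (by positivity)]
  exact h1

/-- The average over the `n`-th circle of the `j`-th coefficient of `R 1`. -/
def average : OperatorFamily (Sobolev β) →L[ℂ] ℂ :=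
  LinearMap.mkContinuous
    { toFun := fun R => (2 * Real.pi : ℂ)⁻¹ *
        ∫ θ in (0 : ℝ)..2 * Real.pi, coeff (R.eval (n, θ) (expFun β 0)) j
      map_add' := by
        intro R S
        rw [← mul_add, ← intervalIntegral.integral_add
          ((continuous_coeff_apply n j R).intervalIntegrable _ _)
          ((continuous_coeff_apply n j S).intervalIntegrable _ _)]
        simp [OperatorFamily.eval_add]
      map_smul' := by
        intro c R
        rw [RingHom.id_apply, smul_eq_mul, mul_left_comm, ← intervalIntegral.integral_const_mul]
        simp [OperatorFamily.eval_smul] }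
    (bracket j ^ β)⁻¹ (by
      intro R
      refine norm_average_le fun θ => ?_
      rw [inv_mul_eq_div, le_div_iff₀ (bracket_rpow_pos j β), mul_comm]
      refine (norm_coeff_le _ _).trans (((R.eval (n, θ)).le_opNorm _).trans ?_)
      rw [norm_expFun_zero, mul_one]
      exact R.norm_eval_le _)

lemma average_apply (R : OperatorFamily (Sobolev β)) :
    average n j R = (2 * Real.pi : ℂ)⁻¹ *
      ∫ θ in (0 : ℝ)..2 * Real.pi, coeff (R.eval (n, θ) (expFun β 0)) j := rfl

lemma average_one : average n j
    (1 : OperatorFamily (Sobolev β)) =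
      coeff (expFun β 0) j := by
  have := Real.pi_ne_zero
  rw [average_apply]
  simp [OperatorFamily.eval_one]
  field_simp

end average

lemma circleIntegral_apply {E F : Type} [NormedAddCommGroup E] [NormedSpace ℂ E]
    [NormedAddCommGroup F] [NormedSpace ℂ F] [CompleteSpace F] {f : ℂ → E →L[ℂ] F} {c : ℂ} {R : ℝ}
    (hf : CircleIntegrable f c R) (ψ : F →L[ℂ] ℂ) (x : E) :
    ψ ((∮ z in C(c, R), f z) x) =
      ∫ θ in (0 : ℝ)..2 * Real.pi, deriv (circleMap c R) θ • ψ (f (circleMap c R θ) x) := by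
  have h := (ψ ∘L ContinuousLinearMap.apply ℂ F x).intervalIntegral_comp_comm hf.out
  rw [circleIntegral]
  simpa using h.symm

lemma coeff_hFun {s : ℝ} (hs : -1 / 2 < s) {u : Sobolev₀ s} (hu : u ∈ goodSet hs) (n : ℕ)
    (j : ℤ) : coeff (hFun hs n u).1 j = average n (j - n) (neumann hs u.1) := by
  have hpt : ∀ θ : ℝ, deriv (circleMap n (1 / 3)) θ • (coeffL j ∘L (Hardy (1 + sig s)).subtypeL)
      (laxResolvent hs u (circleMap n (1 / 3) θ) (hardyExp (sig s) n)) =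
        -Complex.I * coeff ((neumann hs u.1).eval (n, θ) (expFun (1 + s) 0)) (j - n) := by
    intro θ
    have h1 : (coeffL j ∘L (Hardy (1 + sig s)).subtypeL)
      (laxResolvent hs u (circleMap n (1 / 3) θ) (hardyExp (sig s) n)) = _ :=
        coeff_laxResolvent hs hu n θ j
    have h2 : circlePt θ ≠ 0 := norm_pos_iff.1 (by rw [norm_circlePt]; norm_num)
    rw [h1, deriv_circleMap, smul_eq_mul, ← circlePt]
    field_simp
  have hint := circleIntegral_apply (rieszWellDefined hs hu n).2
    (coeffL j ∘L (Hardy (1 + sig s)).subtypeL) (hardyExp (sig s) n)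
  rw [intervalIntegral.integral_congr fun θ _ => hpt θ,
    intervalIntegral.integral_const_mul] at hint
  have hcoeff : coeff (hFun hs n u).1 j = -((2 * Real.pi * Complex.I : ℂ)⁻¹ * _) :=
    congrArg (fun x => -((2 * Real.pi * Complex.I : ℂ)⁻¹ * x)) hint
  rw [hcoeff, average_apply]
  have := Real.pi_ne_zero
  have := Complex.I_ne_zero
  field_simp

/-! ### The pre-Birkhoff map -/

/-- The gain of one power of `⟨l⟩` from the free resolvent, coefficient by coefficient. -/
lemma bracket_mul_norm_lippmann_le {s : ℝ} (hs : -1 / 2 < s) (u : Sobolev s) (t : ℕ × ℝ)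
    (f : Sobolev (1 + s)) (l : ℤ) :
    bracket l ^ (1 + s) * ‖coeff ((lippmann hs u).eval t f) l‖ ≤
      3 * (bracket l ^ s * ‖coeff (mulBilin hs u f) l‖) := by
  have h : coeff ((lippmann hs u).eval t f) l = freeSymbol t.1 t.2 l * coeff (mulBilin hs u f) l := rfl
  rw [h, norm_mul, Real.rpow_add (bracket_pos l), Real.rpow_one]
  have h1 := norm_freeSymbol_le t.1 t.2 l
  have h2 : 0 ≤ bracket l ^ s * ‖coeff (mulBilin hs u f) l‖ :=
    mul_nonneg (bracket_rpow_pos l s).le (norm_nonneg _)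
  nlinarith

/-- Each `n` tests a different vector `R(n, θ) e_0`, but all have norm at most `‖R‖`. The majorant
of `conv_majorant`, independent of the vector, therefore dominates the whole sequence, and it is
summed over the frequencies `-n`. -/
lemma preBirkhoff_bound {s : ℝ} (hs : -1 / 2 < s) (u : Sobolev s)
    (R : OperatorFamily (Sobolev (1 + s))) :
    (Summable fun n : ℕ+ => bracket ((n : ℕ) : ℤ) ^ (2 * (1 + s)) *
      ‖average n (-((n : ℕ) : ℤ)) (lippmann hs u * R)‖ ^ 2) ∧
    ∑' n : ℕ+, bracket ((n : ℕ) : ℤ) ^ (2 * (1 + s)) *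
      ‖average n (-((n : ℕ) : ℤ)) (lippmann hs u * R)‖ ^ 2 ≤
        (3 * mulConst hs * ‖u‖ * ‖R‖) ^ 2 := by
  obtain ⟨W, h0, h1, h2, h3⟩ := conv_majorant hs u
  let φ : ℕ+ → ℤ := fun n => -((n : ℕ) : ℤ)
  have hφ : Function.Injective φ := fun m n h => by
    have : ((m : ℕ) : ℤ) = (n : ℕ) := neg_injective h
    exact_mod_cast this
  have sW : Summable fun n => 9 * ‖R‖ ^ 2 * W (φ n) := (h1.comp_injective hφ).mul_left _
  have hle : ∀ n : ℕ+, bracket ((n : ℕ) : ℤ) ^ (2 * (1 + s)) *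
      ‖average n (-((n : ℕ) : ℤ)) (lippmann hs u * R)‖ ^ 2 ≤ 9 * ‖R‖ ^ 2 * W (φ n) := by
    intro n
    have hb : bracket ((n : ℕ) : ℤ) = bracket (φ n) := (bracket_neg _).symm
    have hw := bracket_rpow_pos (φ n) (1 + s)
    have key : ∀ θ : ℝ,
        ‖coeff ((lippmann hs u * R).eval ((n : ℕ), θ) (expFun (1 + s) 0)) (φ n)‖ ≤
          3 * (√(W (φ n)) * ‖R‖) / bracket (φ n) ^ (1 + s) := by
      intro θ
      rw [le_div_iff₀ hw, mul_comm]
      refine (bracket_mul_norm_lippmann_le hs u _ (R.eval ((n : ℕ), θ) (expFun (1 + s) 0)) _).trans ?_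
      refine mul_le_mul_of_nonneg_left ?_ (by norm_num)
      have hf : ‖R.eval ((n : ℕ), θ) (expFun (1 + s) 0)‖ ≤ ‖R‖ := by
        refine ((R.eval ((n : ℕ), θ)).le_opNorm _).trans ?_
        rw [norm_expFun_zero, mul_one]
        exact R.norm_eval_le _
      refine le_trans ?_ (mul_le_mul_of_nonneg_left hf (Real.sqrt_nonneg _))
      refine abs_le_of_sq_le_sq' ?_ (by positivity) |>.2
      rw [mul_pow, mul_pow, Real.sq_sqrt (h0 _), ← bracket_rpow_two_mul]
      exact (h3 _ _).2
    have hav : ‖average n (-((n : ℕ) : ℤ)) (lippmann hs u * R)‖ ≤ _ := norm_average_le key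
    rw [le_div_iff₀ hw] at hav
    have := pow_le_pow_left₀ (by positivity) hav 2
    rw [hb, bracket_rpow_two_mul]
    rw [mul_pow, mul_pow, mul_pow, Real.sq_sqrt (h0 _)] at this
    linarith
  have hs' := Summable.of_nonneg_of_le
    (fun n => mul_nonneg (bracket_rpow_pos _ _).le (sq_nonneg _)) hle sW
  refine ⟨hs', (hs'.tsum_le_tsum hle sW).trans ?_⟩
  rw [tsum_mul_left]
  have h4 := (Summable.tsum_le_tsum_of_inj φ hφ (fun l _ => h0 l) (fun _ => le_rfl)
    (h1.comp_injective hφ) h1).trans h2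
  calc 9 * ‖R‖ ^ 2 * ∑' n, W (φ n) ≤ 9 * ‖R‖ ^ 2 * (mulConst hs * ‖u‖) ^ 2 := by gcongr
    _ = _ := by ring

/-- The bilinear map which gives `(⟨1, h_n(u)⟩)_{n ≥ 1}` from `u` and the Neumann series. -/
def preBirkhoffBilin {s : ℝ} (hs : -1 / 2 < s) : Sobolev s →L[ℂ]
    OperatorFamily (Sobolev (1 + s)) →L[ℂ]
      SeqPlus (1 + s) :=
  LinearMap.mkContinuous₂
    (LinearMap.mk₂ ℂ (fun (u : Sobolev s)
        (R : OperatorFamily (Sobolev (1 + s))) =>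
      (SeqSpace.mk (fun n : ℕ+ => average n (-((n : ℕ) : ℤ)) (lippmann hs u * R))
        (preBirkhoff_bound hs u R).1 : SeqPlus (1 + s)))
      (by intro u v R; ext n; simp only [coeff_mk, map_add, add_mul, Pi.add_apply])
      (by intro c u R; ext n; simp only [coeff_mk, map_smul, smul_mul_assoc, Pi.smul_apply])
      (by intro u R S; ext n; simp only [coeff_mk, map_add, mul_add, Pi.add_apply])
      (by intro c u R; ext n; simp only [coeff_mk, map_smul, mul_smul_comm, Pi.smul_apply]))
    (3 * mulConst hs) (by
      intro u R
      have := mulConst_nonneg hs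
      refine abs_le_of_sq_le_sq' ?_ (by positivity) |>.2
      rw [norm_sq]
      exact (preBirkhoff_bound hs u R).2)

lemma coeff_preBirkhoffBilin {s : ℝ} (hs : -1 / 2 < s) (u : Sobolev s)
    (R : OperatorFamily (Sobolev (1 + s))) (n : ℕ+) :
    coeff (preBirkhoffBilin hs u R) n = average n (-((n : ℕ) : ℤ)) (lippmann hs u * R) := rfl

lemma bilinPair_expFun_zero {β γ : ℝ} (f : Sobolev γ) :
    bilinPair (expFun β 0) f = coeff f 0 := by
  rw [bilinPair, tsum_eq_single 0 fun n hn => by simp [expFun, hn]]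
  simp [expFun]

lemma sesqPair_expFun {β γ : ℝ} (f : Sobolev γ) (n : ℤ) :
    sesqPair f (expFun β n) = coeff f n := by
  rw [sesqPair, tsum_eq_single n fun m hm => by simp [expFun, hm]]
  simp [expFun]

lemma analyticAt_neumann_val {s : ℝ} (hs : -1 / 2 < s) {u : Sobolev₀ s} (hu : u ∈ goodSet hs) :
    AnalyticAt ℂ (fun v : Sobolev₀ s => neumann hs v.1) u :=
  AnalyticAt.comp (g := neumann hs) (f := fun v : Sobolev₀ s => v.1)
    (analyticAt_neumann (by linarith [hu.1])) ((Sobolev₀ s).subtypeL.analyticAt u)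

end

end BenjaminOno

/-! ### Analyticity of the pre-Birkhoff map and the lower bound -/

theorem mainTheorem7 (s : ℝ) (hs : -1 / 2 < s) :
    ∃ U : Set (BenjaminOno.Sobolev₀ s), IsOpen U ∧ 0 ∈ U ∧
      (∀ u ∈ U, ∀ n : ℕ, BenjaminOno.RieszWellDefined hs n u) ∧
      (∃ Ψ : BenjaminOno.Sobolev₀ s → BenjaminOno.SeqPlus (1 + s),
        AnalyticOnNhd ℂ Ψ U ∧
        ∀ u ∈ U, ∀ n : ℕ+, BenjaminOno.SeqSpace.coeff (Ψ u) n =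
          BenjaminOno.bilinPair (BenjaminOno.expFun (-(1 + BenjaminOno.sig s)) 0)
            (BenjaminOno.hFun hs n u).1) ∧
      ∀ n : ℕ,
        AnalyticOnNhd ℂ (fun u => BenjaminOno.sesqPair (BenjaminOno.hFun hs n u).1
          (BenjaminOno.expFun (-(1 + BenjaminOno.sig s)) n)) U ∧
        ∀ u ∈ U, 1 / 2 ≤ ‖BenjaminOno.sesqPair (BenjaminOno.hFun hs n u).1
          (BenjaminOno.expFun (-(1 + BenjaminOno.sig s)) n)‖ := by
  open BenjaminOno in
  refine ⟨goodSet hs, isOpen_goodSet hs, zero_mem_goodSet hs,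
    fun u hu n => rieszWellDefined hs hu n,
    ⟨fun u => preBirkhoffBilin hs u.1 (neumann hs u.1), fun u hu => ?_, fun u hu n => ?_⟩,
    fun n => ⟨?_, fun u hu => ?_⟩⟩
  -- A bounded bilinear map applied to `u` and the analytic function `N` of `u`.
  · exact AnalyticAt.comp₂ (h := fun p => preBirkhoffBilin hs p.1 p.2)
      ((preBirkhoffBilin hs).analyticAt_bilinear _) ((Sobolev₀ s).subtypeL.analyticAt u)
      (analyticAt_neumann_val hs hu)
  -- The term 1 in `N = 1 + A N` contributes the coefficient of `e_0` at `-n`, which is zero because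
  -- `n ≥ 1`.
  · rw [bilinPair_expFun_zero, coeff_hFun hs hu, coeff_preBirkhoffBilin,
      neumann_eq (show ‖lippmann hs u.1‖ < 1 by linarith [hu.1]), map_add, average_one, zero_sub,
      ← neumann_eq (show ‖lippmann hs u.1‖ < 1 by linarith [hu.1])]
    simp [expFun]
  · have h : AnalyticOnNhd ℂ (fun u : Sobolev₀ s => average n 0 (neumann hs u.1))
        (goodSet hs) := fun u hu =>
      ((average n 0).analyticAt _).comp (analyticAt_neumann_val hs hu)
    refine h.congr (isOpen_goodSet hs) fun u hu => ?_
    simp only [sesqPair_expFun]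
    rw [coeff_hFun hs hu, sub_self]
  · rw [sesqPair_expFun, coeff_hFun hs hu, sub_self]
    have h1 : ‖average n 0 (neumann hs u.1 - 1)‖ ≤ 1 / 2 := by
      refine norm_average_le fun θ => ?_
      have h2 := SeqSpace.norm_coeff_le ((neumann hs u.1 - 1).eval (n, θ) (expFun (1 + s) 0)) 0
      have h3 := ((neumann hs u.1 - 1).eval (n, θ)).le_opNorm (expFun (1 + s) 0)
      have h4 := (neumann hs u.1 - 1).norm_eval_le (n, θ)
      have h5 := norm_neumann_sub_one_le hu.1
      rw [norm_expFun_zero, mul_one] at h3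
      have h6 : bracket 0 = 1 := by simp [bracket]
      rw [h6, Real.one_rpow, one_mul] at h2
      linarith
    rw [map_sub, average_one] at h1
    have h7 : SeqSpace.coeff (expFun (1 + s) 0) 0 = 1 := by simp [expFun]
    rw [h7] at h1
    have h8 := norm_sub_norm_le (1 : ℂ) (1 - average n 0 (neumann hs u.1))
    rw [norm_sub_rev] at h1
    rw [sub_sub_cancel, norm_one] at h8
    linarith
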